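/- **Theorem 5.3 (Lyapunov's second method for Mittag-Leffler stability).** Let $\alpha\in(0,1)$, let $d\ge 1$, let $D\subset\mathbb{R}^d$ be open with $0\in D$, and let $f:D\to\mathbb{R}^d$ satisfy $f(0)=0$ and be Lipschitz continuous in a neighborhood of the origin. Consider the equation $$ {}^{C}\!D^{\alpha}_{0+}x(t)=f(x(t)),\qquad t>0. \tag{1}$$ Here, for a scalar function, ${}^{C}\!D^{\alpha}_{0+}x(t)=\frac{d}{dt}\,\frac{1}{\Gamma(1-\alpha)}\int_0^t (t-\tau)^{-\alpha}\,(x(\tau)-x(0))\,d\tau$ is the Caputo derivative, and it is taken componentwise for vector functions. A solution of (1) on $[0,T)$, $0<T\le\infty$, is a continuous $\varphi:[0,T)\to D$ whose Caputo derivative exists and satisfies (1) at every $t\in(0,T)$. $\Phi(\cdot,x_0)$ denotes the unique solution with $\Phi(0,x_0)=x_0$ on its maximal interval of existence $[0,T_b(x_0))$: every solution starting from $x_0$ is a restriction of it. Assume there is a function $V:\mathbb{R}^d\to[0,\infty)$ such that * (V.1) $V$ is convex and differentiable on $\mathbb{R}^d$; * (V.2) there are constants $a,b,C_1,C_2,r>0$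 such that $C_1\|x\|^a\le V(x)\le C_2\|x\|^b$ for all $x\in\mathbb{R}^d$ with $\|x\|\le r$; * (V.3) there are constants $C_3,c\ge 0$ such that $\langle\nabla V(x),f(x)\rangle\le -C_3\|x\|^c$ for all $x\in D$ with $\|x\|\le r$. Then: * (a) if $C_3=0$, the trivial solution of (1) is stable: for every $\varepsilon>0$ there is $\delta>0$ such that for every $x_0$ with $\|x_0\|<\delta$ the solution $\Phi(\cdot,x_0)$ exists (and is unique in the above sense), $T_b(x_0)=\infty$, and $\|\Phi(t,x_0)\|<\varepsilon$ for all $t\ge 0$; * (b) if $C_3>0$, the trivial solution of (1) is Mittag-Leffler stable: there are constants $\beta,m,\delta>0$ such that for every $x_0$ with $\|x_0\|\le\delta$ the solution $\Phi(\cdot,x_0)$ exists (and is unique in the above sense), $T_b(x_0)=\infty$, and $\sup_{t\ge 0}t^{\beta}\|\Phi(t,x_0)\|\le m$. -/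

import Mathlib

namespace FracODE

/-- The Riemann-Liouville integral of order `α` started at `0`:
`(I^α x)(t) = Γ(α)⁻¹ ∫₀ᵗ (t - τ)^(α-1) x(τ) dτ`. -/
noncomputable def rlIntegral (α : ℝ) (x : ℝ → ℝ) (t : ℝ) : ℝ :=
  (Real.Gamma α)⁻¹ * ∫ τ in (0 : ℝ)..t, (t - τ) ^ (α - 1) * x τ

/-- The scalar function `x` has at `t` the Caputo derivative `y` of order `α` (started at `0`):
the function `I^(1-α) (x - x(0))` is differentiable at `t` with derivative `y`. -/
def HasCaputoDerivAt (α : ℝ) (x : ℝ → ℝ) (y t : ℝ) : Prop :=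
  HasDerivAt (rlIntegral (1 - α) (fun τ => x τ - x 0)) y t

/-- `φ` is a solution on `[0, T)`, `0 < T ≤ ∞`, of the initial value problem
`ᶜD^α x(t) = f(x(t))` for `0 < t < T`, `x(0) = x₀`, where `f` is regarded as a function on `D`:
`φ` is continuous on `[0, T)`, stays in `D`, and its Caputo derivative (taken componentwise)
exists and equals `f(φ(t))` at every `t ∈ (0, T)`. Values of `φ` outside `[0, T)` and values of `f`
outside `D` play no role. -/
structure IsSolution {d : ℕ} (α : ℝ) (D : Set (EuclideanSpace ℝ (Fin d)))
    (f : EuclideanSpace ℝ (Fin d) → EuclideanSpace ℝ (Fin d))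
    (x₀ : EuclideanSpace ℝ (Fin d)) (T : EReal) (φ : ℝ → EuclideanSpace ℝ (Fin d)) : Prop where
  pos : 0 < T
  init : φ 0 = x₀
  cont : ContinuousOn φ {t : ℝ | 0 ≤ t ∧ (t : EReal) < T}
  mem : ∀ t : ℝ, 0 ≤ t → (t : EReal) < T → φ t ∈ D
  caputo : ∀ t : ℝ, 0 < t → (t : EReal) < T →
    ∀ i : Fin d, HasCaputoDerivAt α (fun s => φ s i) (f (φ t) i) t

/-- `Φ` is the solution with initial value `x₀` on its maximal interval of existence `[0, T)`:
it solves the initial value problem on `[0, T)`, and every solution with the same initial value,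
on whatever interval `[0, S)`, is a restriction of it. -/
structure IsMaximalSolution {d : ℕ} (α : ℝ) (D : Set (EuclideanSpace ℝ (Fin d)))
    (f : EuclideanSpace ℝ (Fin d) → EuclideanSpace ℝ (Fin d))
    (x₀ : EuclideanSpace ℝ (Fin d)) (T : EReal) (Φ : ℝ → EuclideanSpace ℝ (Fin d)) : Prop where
  isSolution : IsSolution α D f x₀ T Φ
  maximal : ∀ (S : EReal) (ψ : ℝ → EuclideanSpace ℝ (Fin d)), IsSolution α D f x₀ S ψ →
    S ≤ T ∧ ∀ t : ℝ, 0 ≤ t → (t : EReal) < S → ψ t = Φ t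

/-- The trivial solution is stable: for every `ε > 0` there is `δ > 0` such that for `‖x₀‖ < δ` the
solution from `x₀` has maximal interval of existence `[0, ∞)` and norm `< ε` for all `t ≥ 0`. -/
def IsStable {d : ℕ} (α : ℝ) (D : Set (EuclideanSpace ℝ (Fin d)))
    (f : EuclideanSpace ℝ (Fin d) → EuclideanSpace ℝ (Fin d)) : Prop :=
  ∀ ε : ℝ, 0 < ε → ∃ δ : ℝ, 0 < δ ∧ ∀ x₀ : EuclideanSpace ℝ (Fin d), ‖x₀‖ < δ →
    ∃ Φ : ℝ → EuclideanSpace ℝ (Fin d), IsMaximalSolution α D f x₀ ⊤ Φ ∧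
      ∀ t : ℝ, 0 ≤ t → ‖Φ t‖ < ε

/-- The trivial solution is Mittag-Leffler stable: there are `β, m, δ > 0` such that for
`‖x₀‖ ≤ δ` the solution `Φ` from `x₀` exists on `[0, ∞)` and `t^β ‖Φ(t)‖ ≤ m` for all `t ≥ 0`. -/
def IsMittagLefflerStable {d : ℕ} (α : ℝ) (D : Set (EuclideanSpace ℝ (Fin d)))
    (f : EuclideanSpace ℝ (Fin d) → EuclideanSpace ℝ (Fin d)) : Prop :=
  ∃ β m δ : ℝ, 0 < β ∧ 0 < m ∧ 0 < δ ∧ ∀ x₀ : EuclideanSpace ℝ (Fin d), ‖x₀‖ ≤ δ →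
    ∃ Φ : ℝ → EuclideanSpace ℝ (Fin d), IsMaximalSolution α D f x₀ ⊤ Φ ∧
      ∀ t : ℝ, 0 ≤ t → t ^ β * ‖Φ t‖ ≤ m

end FracODE

/-!
The equation `ᶜD^α x = f(x)` is equivalent to the Volterra equation `x = x₀ + I^α f(x)`: this is the
semigroup property `fracInt_fracInt` of the Riemann-Liouville integrals `I^a`
(`hasCaputoDerivAt_of_volterra`, `HasCaputoDerivAt.eq_add_fracInt`). Near the origin `f` is the
restriction of a globally Lipschitz map `g`, for which the Volterra equation has a unique solution
`Φ` on `[0, ∞)` (`exists_volterra_solution`, `volterra_solution_unique`). If `Φ` stays in the ball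
where `f = g`, it is the maximal solution of the original equation
(`isMaximalSolution_of_volterra`).

The Lyapunov function confines `Φ` to that ball. Let `M` be a scalar function that starts above
`V x₀`, and suppose that `V (Φ t)` meets `M t` for the first time at `t > 0`. With
`c = ∇V (Φ t)`, convexity gives `⟪c, Φ s - Φ t⟫ ≤ V (Φ s) - V (Φ t) ≤ M s - M t` for `s ≤ t`, so that
`u s = ⟪c, Φ s⟫ - M s` has its maximum over `[0, t]` at `t`, and it is strictly larger there than at
`0`. The extremum principle `HasCaputoDerivAt.le_of_isMax` then says that the Caputo derivative of `u`
at `t` is positive, that is, `⟪∇V (Φ t), f (Φ t)⟫ > ᶜD^α M t`. This is a contradiction as soon as `M`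
is a supersolution (`lyapunov_comparison`). Only a linear functional of `Φ` is differentiated, so
the Caputo derivative of `V ∘ Φ` is never needed. The extremum principle holds for `Φ`, although `Φ`
may fail to be differentiable, because `Φ t - Φ (t - h) = o(h ^ α)` at positive times
(`isLittleO_fracInt_sub`).

Stability follows with a constant `M`. Mittag-Leffler stability follows with
`M t = m * (1 + t) ^ (-β)`: by the bounds on `V`, the decay condition reads
`⟪∇V x, f x⟫ ≤ -k * V x ^ p` with `p = c / b`, and for small `β` this `M` is a supersolution of
`ᶜD^α M = -k * M ^ p` (`exists_power_supersolution`), since `I^(1-α)` of `(1 + t)⁻¹` decays like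
`t ^ (-α / 2)` at least.
-/

namespace FracODE

open MeasureTheory Set Filter Topology Asymptotics

variable {E : Type*} [NormedAddCommGroup E] [NormedSpace ℝ E] {d : ℕ}

/-! ### The Riemann-Liouville integral -/

theorem intervalIntegrable_kernel {a : ℝ} (ha : 0 < a) (t p q : ℝ) :
    IntervalIntegrable (fun τ => (t - τ) ^ (a - 1)) volume p q := by
  have h := (intervalIntegral.intervalIntegrable_rpow' (r := a - 1) (by linarith)
    (a := t - p) (b := t - q)).comp_sub_left t
  simpa using h

theorem intervalIntegrable_kernel_smul {a : ℝ} (ha : 0 < a) {x : ℝ → E} (t : ℝ) {p q : ℝ}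
    (hx : ContinuousOn x (uIcc p q)) :
    IntervalIntegrable (fun τ => (t - τ) ^ (a - 1) • x τ) volume p q :=
  (intervalIntegrable_kernel ha t p q).smul_continuousOn hx

theorem integral_kernel {a : ℝ} (ha : 0 < a) (t p q : ℝ) :
    ∫ τ in p..q, (t - τ) ^ (a - 1) = ((t - p) ^ a - (t - q) ^ a) / a := by
  rw [intervalIntegral.integral_comp_sub_left (fun s => s ^ (a - 1)) t,
    integral_rpow (Or.inl (by linarith))]
  simp

/-- The Riemann-Liouville integral of order `a` of a vector-valued function; on real-valued
functions it is `rlIntegral`. -/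
noncomputable def fracInt (a : ℝ) (x : ℝ → E) (t : ℝ) : E :=
  (Real.Gamma a)⁻¹ • ∫ τ in (0 : ℝ)..t, (t - τ) ^ (a - 1) • x τ

theorem rlIntegral_eq_fracInt : rlIntegral = fracInt (E := ℝ) := rfl

@[simp]
theorem fracInt_zero_right (a : ℝ) (x : ℝ → E) : fracInt a x 0 = 0 := by
  simp [fracInt]

theorem fracInt_congr {a t : ℝ} {x y : ℝ → E} (ht : 0 ≤ t) (h : ∀ s ∈ Icc 0 t, x s = y s) :
    fracInt a x t = fracInt a y t := by
  unfold fracInt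
  congr 1
  refine intervalIntegral.integral_congr fun s hs => ?_
  rw [uIcc_of_le ht] at hs
  simp only [h s hs]

theorem fracInt_sub {a t : ℝ} (ha : 0 < a) {x y : ℝ → E} (hx : ContinuousOn x (uIcc 0 t))
    (hy : ContinuousOn y (uIcc 0 t)) :
    fracInt a (fun s => x s - y s) t = fracInt a x t - fracInt a y t := by
  unfold fracInt
  simp only [smul_sub]
  rw [intervalIntegral.integral_sub (intervalIntegrable_kernel_smul ha t hx)
    (intervalIntegrable_kernel_smul ha t hy), smul_sub]

theorem fracInt_clm [CompleteSpace E] {F : Type*} [NormedAddCommGroup F] [NormedSpace ℝ F]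
    [CompleteSpace F] {a t : ℝ} (ha : 0 < a) {x : ℝ → E} (hx : ContinuousOn x (uIcc 0 t))
    (L : E →L[ℝ] F) : fracInt a (fun s => L (x s)) t = L (fracInt a x t) := by
  unfold fracInt
  rw [map_smul, ← L.intervalIntegral_comp_comm (intervalIntegrable_kernel_smul ha t hx)]
  simp

theorem fracInt_const [CompleteSpace E] {a : ℝ} (ha : 0 < a) (c : E) (t : ℝ) :
    fracInt a (fun _ => c) t = (t ^ a / Real.Gamma (a + 1)) • c := by
  unfold fracInt
  rw [intervalIntegral.integral_smul_const, integral_kernel ha, smul_smul,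
    Real.Gamma_add_one ha.ne']
  congr 1
  simp only [sub_zero, sub_self, Real.zero_rpow ha.ne']
  field_simp

theorem fracInt_one (x : ℝ → E) (t : ℝ) : fracInt 1 x t = ∫ τ in (0 : ℝ)..t, x τ := by
  simp [fracInt]

theorem norm_fracInt_le {a t : ℝ} (ha : 0 < a) (ht : 0 ≤ t) {x : ℝ → E} {y : ℝ → ℝ}
    (hy : ContinuousOn y (uIcc 0 t)) (h : ∀ s ∈ Icc 0 t, ‖x s‖ ≤ y s) :
    ‖fracInt a x t‖ ≤ fracInt a y t := by
  unfold fracInt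
  rw [norm_smul, Real.norm_of_nonneg (inv_nonneg.2 (Real.Gamma_pos_of_pos ha).le), smul_eq_mul]
  refine mul_le_mul_of_nonneg_left ?_ (inv_nonneg.2 (Real.Gamma_pos_of_pos ha).le)
  refine intervalIntegral.norm_integral_le_of_norm_le ht (ae_of_all _ fun s hs => ?_)
    (intervalIntegrable_kernel_smul ha t hy)
  rw [norm_smul, Real.norm_of_nonneg (Real.rpow_nonneg (by linarith [hs.2]) _), smul_eq_mul]
  exact mul_le_mul_of_nonneg_left (h s ⟨hs.1.le, hs.2⟩) (Real.rpow_nonneg (by linarith [hs.2]) _)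

theorem fracInt_mono {a t : ℝ} (ha : 0 < a) (ht : 0 ≤ t) {x y : ℝ → ℝ}
    (hx : ContinuousOn x (uIcc 0 t)) (hy : ContinuousOn y (uIcc 0 t))
    (h : ∀ s ∈ Icc 0 t, x s ≤ y s) :
    fracInt a x t ≤ fracInt a y t := by
  unfold fracInt
  rw [smul_eq_mul, smul_eq_mul]
  refine mul_le_mul_of_nonneg_left ?_ (inv_nonneg.2 (Real.Gamma_pos_of_pos ha).le)
  refine intervalIntegral.integral_mono_on ht (intervalIntegrable_kernel_smul ha t hx)
    (intervalIntegrable_kernel_smul ha t hy) fun s hs => ?_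
  exact mul_le_mul_of_nonneg_left (h s hs) (Real.rpow_nonneg (by linarith [hs.2]) _)

/-- The fractional integral as an integral over the fixed interval `[0, 1]`. -/
theorem fracInt_eq_unit {a t : ℝ} (ha : 0 < a) (ht : 0 ≤ t) (x : ℝ → E) :
    fracInt a x t =
      (t ^ a / Real.Gamma a) • ∫ u in (0 : ℝ)..1, (1 - u) ^ (a - 1) • x (t * u) := by
  rcases ht.eq_or_lt with rfl | ht
  · simp [Real.zero_rpow ha.ne']
  have h := intervalIntegral.integral_comp_mul_left (a := 0) (b := 1)
    (fun τ => (t - τ) ^ (a - 1) • x τ) ht.ne'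
  rw [mul_zero, mul_one, eq_inv_smul_iff₀ ht.ne'] at h
  rw [fracInt, ← h, ← intervalIntegral.integral_smul, ← intervalIntegral.integral_smul,
    ← intervalIntegral.integral_smul]
  refine intervalIntegral.integral_congr fun u hu => ?_
  rw [uIcc_of_le zero_le_one] at hu
  simp only [smul_smul]
  congr 1
  rw [show t - t * u = t * (1 - u) by ring, Real.mul_rpow ht.le (by linarith [hu.2]),
    Real.rpow_sub_one ht.ne' a]
  field_simp

theorem continuousOn_fracInt {a : ℝ} (ha : 0 < a) {x : ℝ → E} (hx : Continuous x) :
    ContinuousOn (fracInt a x) (Ici 0) := by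
  have key : Continuous fun t : ℝ =>
      (t ^ a / Real.Gamma a) • ∫ u in (0 : ℝ)..1, (1 - u) ^ (a - 1) • x (t * u) := by
    refine ((Real.continuous_rpow_const ha.le).div_const _).smul ?_
    refine continuous_iff_continuousAt.2 fun t₀ => ?_
    obtain ⟨B, hB⟩ := ((isCompact_Icc (a := -(|t₀| + 1)) (b := |t₀| + 1)).image
      hx.norm).bddAbove
    have hBd : ∀ s : ℝ, |s| ≤ |t₀| + 1 → ‖x s‖ ≤ B := fun s hs =>
      hB ⟨s, abs_le.1 hs, rfl⟩
    refine intervalIntegral.continuousAt_of_dominated_interval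
      (bound := fun u => ‖(1 - u) ^ (a - 1)‖ * B) ?_ ?_ ?_ ?_
    · refine Eventually.of_forall fun t => ?_
      exact (intervalIntegrable_kernel_smul ha 1
        (hx.comp (continuous_const.mul continuous_id)).continuousOn).aestronglyMeasurable_restrict_uIoc
    · have : ∀ᶠ t in 𝓝 t₀, |t| < |t₀| + 1 :=
        continuous_abs.continuousAt.eventually_lt continuousAt_const (by simp)
      filter_upwards [this] with t ht
      refine ae_of_all _ fun u hu => ?_
      rw [uIoc_of_le zero_le_one] at hu
      rw [norm_smul]
      refine mul_le_mul_of_nonneg_left (hBd _ ?_) (norm_nonneg _)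
      rw [abs_mul, abs_of_pos hu.1]
      nlinarith [hu.1, hu.2, abs_nonneg t]
    · exact (intervalIntegrable_kernel ha 1 0 1).norm.mul_const B
    · exact ae_of_all _ fun u _ => by fun_prop
  exact key.continuousOn.congr fun t ht => fracInt_eq_unit ha ht x

/-! ### The semigroup property -/

/-- The Beta integral with its value in terms of the Gamma function. -/
theorem integral_beta {a b : ℝ} (ha : 0 < a) (hb : 0 < b) {t : ℝ} (ht : 0 < t) :
    ∫ s in (0 : ℝ)..t, (t - s) ^ (a - 1) * s ^ (b - 1) =
      Real.Gamma a * Real.Gamma b / Real.Gamma (a + b) * t ^ (a + b - 1) := by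
  have h := Complex.betaIntegral_scaled (b : ℂ) (a : ℂ) ht
  have hG := Complex.Gamma_mul_Gamma_eq_betaIntegral (s := (b : ℂ)) (t := (a : ℂ))
    (by simpa) (by simpa)
  have hne : (Real.Gamma (a + b) : ℂ) ≠ 0 :=
    Complex.ofReal_ne_zero.2 (Real.Gamma_pos_of_pos (add_pos ha hb)).ne'
  have hβ : Complex.betaIntegral b a =
      ((Real.Gamma a * Real.Gamma b / Real.Gamma (a + b) : ℝ) : ℂ) := by
    push_cast
    rw [eq_div_iff hne, mul_comm, ← Complex.Gamma_ofReal, ← Complex.Gamma_ofReal,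
      ← Complex.Gamma_ofReal]
    push_cast
    rw [add_comm (a : ℂ) b, ← hG, mul_comm]
  rw [hβ] at h
  have hl : ∫ s in (0 : ℝ)..t, (s : ℂ) ^ ((b : ℂ) - 1) * ((t : ℂ) - s) ^ ((a : ℂ) - 1) =
      ((∫ s in (0 : ℝ)..t, (t - s) ^ (a - 1) * s ^ (b - 1) : ℝ) : ℂ) := by
    rw [← intervalIntegral.integral_ofReal]
    refine intervalIntegral.integral_congr fun s hs => ?_
    rw [uIcc_of_le ht.le] at hs
    push_cast [Complex.ofReal_cpow hs.1, Complex.ofReal_cpow (sub_nonneg.2 hs.2)]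
    ring
  rw [hl] at h
  have hr : (t : ℂ) ^ ((b : ℂ) + a - 1) = ((t ^ (a + b - 1) : ℝ) : ℂ) := by
    rw [Complex.ofReal_cpow ht.le]; push_cast; ring_nf
  rw [hr, ← Complex.ofReal_mul] at h
  rw [Complex.ofReal_injective h, mul_comm]

theorem integral_beta_shift {a b : ℝ} (ha : 0 < a) (hb : 0 < b) {p t : ℝ} (hpt : p < t) :
    ∫ s in p..t, (t - s) ^ (a - 1) * (s - p) ^ (b - 1) =
      Real.Gamma a * Real.Gamma b / Real.Gamma (a + b) * (t - p) ^ (a + b - 1) := by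
  have h := intervalIntegral.integral_comp_sub_right (a := p) (b := t)
    (fun s => (t - p - s) ^ (a - 1) * s ^ (b - 1)) p
  rw [sub_self, integral_beta ha hb (sub_pos.2 hpt)] at h
  rw [← h]
  congr 1
  ext s
  congr 2
  ring

theorem fracInt_eq_setIntegral (a : ℝ) (x : ℝ → E) {t : ℝ} (ht : 0 ≤ t) :
    fracInt a x t = (Real.Gamma a)⁻¹ • ∫ τ in Ioc 0 t, (t - τ) ^ (a - 1) • x τ := by
  rw [fracInt, intervalIntegral.integral_of_le ht]

/-- The integrand of the iterated fractional integral `I^a I^b x (t)` without the Gamma factors,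
extended by zero to `τ ≥ s`, so that both variables can range over `(0, t]`. -/
noncomputable def triangleIntegrand (a b t : ℝ) (x : ℝ → ℝ) (s τ : ℝ) : ℝ :=
  {p : ℝ × ℝ | p.2 < p.1}.indicator
    (fun p => (t - p.1) ^ (a - 1) * ((p.1 - p.2) ^ (b - 1) * x p.2)) (s, τ)

theorem triangleIntegrand_section_right (a b t : ℝ) (x : ℝ → ℝ) (s : ℝ) :
    triangleIntegrand a b t x s =
      (Iio s).indicator fun τ => (t - s) ^ (a - 1) * ((s - τ) ^ (b - 1) * x τ) := by
  ext τ
  by_cases h : τ < s <;> simp [triangleIntegrand, indicator, h]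

theorem triangleIntegrand_section_left (a b t : ℝ) (x : ℝ → ℝ) (τ : ℝ) :
    (fun s => triangleIntegrand a b t x s τ) =
      (Ioi τ).indicator fun s => (t - s) ^ (a - 1) * ((s - τ) ^ (b - 1) * x τ) := by
  ext s
  by_cases h : τ < s <;> simp [triangleIntegrand, indicator, h]

theorem setIntegral_triangleIntegrand_right (a : ℝ) {b t : ℝ} (hb : 0 < b) (x : ℝ → ℝ) {s : ℝ}
    (hs : s ∈ Ioc 0 t) :
    ∫ τ in Ioc 0 t, triangleIntegrand a b t x s τ =
      Real.Gamma b * ((t - s) ^ (a - 1) * fracInt b x s) := by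
  have hΓ := (Real.Gamma_pos_of_pos hb).ne'
  rw [triangleIntegrand_section_right, setIntegral_indicator measurableSet_Iio,
    show Ioc 0 t ∩ Iio s = Ioo 0 s by ext; simp; grind,
    ← integral_Ioc_eq_integral_Ioo, integral_const_mul, fracInt_eq_setIntegral b x hs.1.le]
  simp only [smul_eq_mul]
  field_simp

theorem norm_triangleIntegrand {a b t s : ℝ} (hst : s ≤ t) (x : ℝ → ℝ) (τ : ℝ) :
    ‖triangleIntegrand a b t x s τ‖ = triangleIntegrand a b t (fun r => ‖x r‖) s τ := by
  by_cases h : τ < s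
  · simp [triangleIntegrand, indicator, h, abs_of_nonneg (Real.rpow_nonneg (sub_nonneg.2 hst) _),
      abs_of_nonneg (Real.rpow_nonneg (sub_nonneg.2 h.le) _)]
  · simp [triangleIntegrand, indicator, h]

theorem integrable_triangleIntegrand {a b t : ℝ} (ha : 0 < a) (hb : 0 < b) (ht : 0 ≤ t)
    {x : ℝ → ℝ} (hx : Continuous x) :
    Integrable (Function.uncurry (triangleIntegrand a b t x))
      ((volume.restrict (Ioc 0 t)).prod (volume.restrict (Ioc 0 t))) := by
  have hmeas : Measurable (Function.uncurry (triangleIntegrand a b t x)) := by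
    have : Function.uncurry (triangleIntegrand a b t x) = {p : ℝ × ℝ | p.2 < p.1}.indicator
        (fun p => (t - p.1) ^ (a - 1) * ((p.1 - p.2) ^ (b - 1) * x p.2)) := rfl
    rw [this]
    have := hx.measurable
    exact Measurable.indicator (by fun_prop) (measurableSet_lt measurable_snd measurable_fst)
  rw [integrable_prod_iff hmeas.aestronglyMeasurable]
  constructor
  · refine (ae_restrict_iff' measurableSet_Ioc).2 (ae_of_all _ fun s hs => ?_)
    change Integrable (triangleIntegrand a b t x s) _
    rw [triangleIntegrand_section_right]
    refine IntegrableOn.integrable_indicator ?_ measurableSet_Iio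
    rw [IntegrableOn, Measure.restrict_restrict measurableSet_Iio,
      show Iio s ∩ Ioc 0 t = Ioo 0 s by ext; simp; grind]
    have h := (intervalIntegrable_kernel_smul hb s (p := 0) (q := s) hx.continuousOn).const_mul
      ((t - s) ^ (a - 1))
    exact ((intervalIntegrable_iff_integrableOn_Ioc_of_le hs.1.le).1 h).mono_set Ioo_subset_Ioc_self
  · have h := (intervalIntegrable_kernel_smul ha t (p := 0) (q := t)
      ((continuousOn_fracInt hb hx.norm).mono
        (by rw [uIcc_of_le ht]; exact Icc_subset_Ici_self))).const_mul (Real.Gamma b)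
    rw [intervalIntegrable_iff_integrableOn_Ioc_of_le ht] at h
    refine h.congr_fun (fun s hs => ?_) measurableSet_Ioc
    simp only [Function.uncurry_apply_pair]
    simp_rw [norm_triangleIntegrand hs.2]
    rw [setIntegral_triangleIntegrand_right a hb _ hs, smul_eq_mul]

/-- The semigroup property of the Riemann-Liouville integrals. -/
theorem fracInt_fracInt {a b t : ℝ} (ha : 0 < a) (hb : 0 < b) (ht : 0 ≤ t) {x : ℝ → ℝ}
    (hx : Continuous x) : fracInt a (fracInt b x) t = fracInt (a + b) x t := by
  have hΓa := (Real.Gamma_pos_of_pos ha).ne'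
  have hΓb := (Real.Gamma_pos_of_pos hb).ne'
  have hΓ := (Real.Gamma_pos_of_pos (add_pos ha hb)).ne'
  have hswap := integral_integral_swap (integrable_triangleIntegrand ha hb ht hx)
  rw [setIntegral_congr_fun measurableSet_Ioc
    (fun s hs => setIntegral_triangleIntegrand_right a hb x hs), integral_const_mul] at hswap
  have hinner : ∀ τ ∈ Ioc 0 t, ∫ s in Ioc 0 t, triangleIntegrand a b t x s τ =
      Real.Gamma a * Real.Gamma b / Real.Gamma (a + b) * ((t - τ) ^ (a + b - 1) * x τ) ∨ τ = t := by
    intro τ hτ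
    rcases hτ.2.eq_or_lt with h | hτt
    · exact Or.inr h
    left
    rw [triangleIntegrand_section_left, setIntegral_indicator measurableSet_Ioi,
      show Ioc 0 t ∩ Ioi τ = Ioc τ t by ext; simp; grind]
    simp only [← mul_assoc]
    rw [integral_mul_const, ← intervalIntegral.integral_of_le hτ.2,
      integral_beta_shift ha hb hτt]
  rw [integral_Ioc_eq_integral_Ioo (f := fun τ => ∫ s in Ioc 0 t, triangleIntegrand a b t x s τ),
    setIntegral_congr_fun measurableSet_Ioo
      (fun τ hτ => (hinner τ ⟨hτ.1, hτ.2.le⟩).resolve_right hτ.2.ne),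
    ← integral_Ioc_eq_integral_Ioo, integral_const_mul] at hswap
  rw [fracInt_eq_setIntegral a _ ht, fracInt_eq_setIntegral (a + b) _ ht]
  simp only [smul_eq_mul]
  field_simp at hswap ⊢
  linarith

/-! ### Caputo derivatives of fractional integrals -/

/-- Freezing a function at its value at `0` on the negative half-line turns continuity on `[0, ∞)`
into continuity on `ℝ`. -/
theorem continuous_comp_max_zero {F : Type*} [TopologicalSpace F] {z : ℝ → F}
    (hz : ContinuousOn z (Ici 0)) : Continuous fun s => z (max s 0) :=
  hz.comp_continuous (by fun_prop) fun s => le_max_right s 0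

/-- The hypothesis says that `I^(1-α) (x - x 0)`, whose derivative is the Caputo derivative of `x`,
is a primitive of `z`. -/
theorem hasCaputoDerivAt_of_eq_integral {α t : ℝ} (ht : 0 < t) {x z : ℝ → ℝ}
    (hz : ContinuousOn z (Ici 0))
    (h : ∀ s, 0 ≤ s → fracInt (1 - α) (fun τ => x τ - x 0) s = ∫ τ in (0 : ℝ)..s, z τ) :
    HasCaputoDerivAt α x (z t) t := by
  have hd := ((continuous_comp_max_zero hz).integral_hasStrictDerivAt 0 t).hasDerivAt
  rw [max_eq_left ht.le] at hd
  refine hd.congr_of_eventuallyEq ?_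
  filter_upwards [lt_mem_nhds ht] with s hs
  rw [rlIntegral_eq_fracInt, h s hs.le]
  refine intervalIntegral.integral_congr fun τ hτ => ?_
  rw [uIcc_of_le hs.le] at hτ
  simp only [max_eq_left hτ.1]

/-- A solution of the Volterra equation `x = x 0 + I^α q` has Caputo derivative `q`, because
`I^(1-α) I^α q` is the ordinary primitive of `q`. -/
theorem hasCaputoDerivAt_of_volterra {α t : ℝ} (hα₀ : 0 < α) (hα₁ : α < 1) (ht : 0 < t)
    {x q : ℝ → ℝ} (hq : Continuous q) (h : ∀ s, 0 ≤ s → x s = x 0 + fracInt α q s) :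
    HasCaputoDerivAt α x (q t) t := by
  refine hasCaputoDerivAt_of_eq_integral ht hq.continuousOn fun s hs => ?_
  rw [fracInt_congr hs (y := fracInt α q) fun τ hτ => by rw [h τ hτ.1]; ring,
    fracInt_fracInt (by linarith) hα₀ hs hq, sub_add_cancel, fracInt_one]

/-- The Caputo derivative of a continuously differentiable function `x` is the fractional
integral of order `1 - α` of its derivative. -/
theorem hasCaputoDerivAt_of_eq_add_integral {α t : ℝ} (hα₁ : α < 1) (ht : 0 < t) {x x' : ℝ → ℝ}
    (hx' : Continuous x') (h : ∀ s, 0 ≤ s → x s = x 0 + ∫ τ in (0 : ℝ)..s, x' τ) :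
    HasCaputoDerivAt α x (fracInt (1 - α) x' t) t := by
  have h1 : 0 < 1 - α := by linarith
  refine hasCaputoDerivAt_of_eq_integral ht (continuousOn_fracInt h1 hx') fun s hs => ?_
  rw [fracInt_congr hs (y := fracInt 1 x') fun τ hτ => by rw [h τ hτ.1, fracInt_one]; ring,
    fracInt_fracInt h1 one_pos hs hx', add_comm, ← fracInt_fracInt one_pos h1 hs hx', fracInt_one]

theorem HasCaputoDerivAt.sub {α y z t : ℝ} (hα₁ : α < 1) {u v : ℝ → ℝ}
    (hu : Continuous u) (hv : Continuous v) (h : HasCaputoDerivAt α u y t)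
    (h' : HasCaputoDerivAt α v z t) : HasCaputoDerivAt α (fun s => u s - v s) (y - z) t := by
  refine (HasDerivAt.sub h h').congr_of_eventuallyEq (Eventually.of_forall fun s => ?_)
  rw [rlIntegral_eq_fracInt, Pi.sub_apply,
    ← fracInt_sub (by linarith) (by fun_prop) (by fun_prop)]
  congr 1
  ext τ
  ring

/-! ### One-sided regularity of fractional integrals -/

theorem isLittleO_id_rpow {α : ℝ} (hα₁ : α < 1) :
    (fun h : ℝ => h) =o[𝓝[>] 0] fun h => h ^ α := by
  have hlim : Tendsto (fun h : ℝ => h ^ (1 - α)) (𝓝[>] 0) (𝓝 0) := by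
    have := (Real.continuous_rpow_const (q := 1 - α) (by linarith)).tendsto 0
    rw [Real.zero_rpow (by linarith)] at this
    exact this.mono_left nhdsWithin_le_nhds
  refine (isLittleO_iff_tendsto' ?_).2 (hlim.congr' ?_)
  · filter_upwards [self_mem_nhdsWithin] with h hh h0
    exact absurd h0 (Real.rpow_pos_of_pos hh α).ne'
  · filter_upwards [self_mem_nhdsWithin] with h hh
    rw [Real.rpow_sub hh, Real.rpow_one]

theorem isLittleO_sub_of_differentiableAt {α t : ℝ} (hα₁ : α < 1) {x : ℝ → ℝ}
    (hx : DifferentiableAt ℝ x t) :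
    (fun h => x t - x (t - h)) =o[𝓝[>] 0] fun h => h ^ α := by
  refine IsBigO.trans_isLittleO ?_ (isLittleO_id_rpow hα₁)
  have hlim : Tendsto (fun h : ℝ => t - h) (𝓝[>] 0) (𝓝 t) := by
    have : Tendsto (fun h : ℝ => t - h) (𝓝 0) (𝓝 (t - 0)) :=
      (continuous_const.sub continuous_id).tendsto 0
    rw [sub_zero] at this
    exact this.mono_left nhdsWithin_le_nhds
  have := (hx.isBigO_sub.comp_tendsto hlim).neg_left
  refine (this.neg_right).congr (fun h => ?_) (fun h => ?_) <;> simp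

/-- Estimate for the change of the kernel `(t - s) ^ (α - 1)` under a shift of `t` by `h`, on an
interval `[c, d]` to the left of `t - h`. -/
theorem norm_integral_kernel_sub_le {α b c d t h : ℝ} (hα₀ : 0 < α) (hα₁ : α < 1) (hh : 0 < h)
    (hcd : c ≤ d) (hd : d ≤ t - h) {p : ℝ → ℝ} (hp : ∀ s ∈ Icc c d, ‖p s‖ ≤ b) :
    ‖∫ s in c..d, ((t - h - s) ^ (α - 1) - (t - s) ^ (α - 1)) * p s‖ ≤
      b * (((t - h - c) ^ α - (t - h - d) ^ α) / α - ((t - c) ^ α - (t - d) ^ α) / α) := by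
  have hi := (intervalIntegrable_kernel hα₀ (t - h) c d).sub (intervalIntegrable_kernel hα₀ t c d)
  rw [← integral_kernel hα₀, ← integral_kernel hα₀, ← intervalIntegral.integral_sub
    (intervalIntegrable_kernel hα₀ (t - h) c d) (intervalIntegrable_kernel hα₀ t c d),
    ← intervalIntegral.integral_const_mul]
  -- the endpoint `s = d` is left out: for `d = t - h`, Lean's `0 ^ (α - 1) = 0` breaks the bound there
  refine intervalIntegral.norm_integral_le_of_norm_le hcd ?_ (hi.const_mul b)
  filter_upwards [(measure_eq_zero_iff_ae_notMem.1 (measure_singleton d))] with s hsd hs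
  have hsd' : s < d := lt_of_le_of_ne hs.2 hsd
  rw [norm_mul, mul_comm]
  have hk : (t - s) ^ (α - 1) ≤ (t - h - s) ^ (α - 1) :=
    Real.rpow_le_rpow_of_nonpos (by linarith) (by linarith) (by linarith)
  rw [Real.norm_of_nonneg (sub_nonneg.2 hk)]
  exact mul_le_mul_of_nonneg_right (hp s ⟨hs.1.le, hs.2⟩) (sub_nonneg.2 hk)

theorem norm_integral_kernel_le {α b c t : ℝ} (hα₀ : 0 < α) (hct : c ≤ t)
    {p : ℝ → ℝ} (hp : ∀ s ∈ Icc c t, ‖p s‖ ≤ b) :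
    ‖∫ s in c..t, (t - s) ^ (α - 1) * p s‖ ≤ b * ((t - c) ^ α / α) := by
  have h0 : ∫ s in c..t, (t - s) ^ (α - 1) = (t - c) ^ α / α := by
    rw [integral_kernel hα₀]; simp [Real.zero_rpow hα₀.ne']
  rw [← h0, ← intervalIntegral.integral_const_mul]
  refine intervalIntegral.norm_integral_le_of_norm_le hct (ae_of_all _ fun s hs => ?_)
    ((intervalIntegrable_kernel hα₀ t c t).const_mul b)
  have hk : 0 ≤ (t - s) ^ (α - 1) := Real.rpow_nonneg (by linarith [hs.2]) _
  rw [norm_mul, Real.norm_of_nonneg hk, mul_comm]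
  exact mul_le_mul_of_nonneg_right (hp s ⟨hs.1.le, hs.2⟩) hk

/-- The case of `isLittleO_fracInt_sub` in which the integrand vanishes at `t`: near `t` the
integrand is small and contributes at most `ε * h ^ α`, while the part of the integral away from `t`
is differentiable in `h`. -/
theorem isLittleO_fracInt_sub_of_eq_zero {α t : ℝ} (hα₀ : 0 < α) (hα₁ : α < 1) (ht : 0 < t)
    {p : ℝ → ℝ} (hp : Continuous p) (hpt : p t = 0) :
    (fun h => fracInt α p t - fracInt α p (t - h)) =o[𝓝[>] 0] fun h => h ^ α := by
  have hΓ := Real.Gamma_pos_of_pos hα₀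
  rw [isLittleO_iff]
  intro ε hε
  obtain ⟨ε', hε', hεeq⟩ : ∃ ε', 0 < ε' ∧ (Real.Gamma α)⁻¹ * (ε' * (2 / α + 1)) = ε :=
    ⟨ε * Real.Gamma α / (2 / α + 1), by positivity, by field_simp⟩
  obtain ⟨η, hη, hηt, hsmall⟩ : ∃ η, 0 < η ∧ η ≤ t ∧ ∀ s ∈ Icc (t - η) t, ‖p s‖ ≤ ε' := by
    obtain ⟨δ, hδ, h⟩ := Metric.continuous_iff.1 hp t ε' hε'
    refine ⟨min (δ / 2) t, by positivity, min_le_right _ _, fun s hs => ?_⟩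
    have := min_le_left (δ / 2) t
    have h2 := h s (by rw [Real.dist_eq, abs_lt]; constructor <;> linarith [hs.1, hs.2])
    rw [hpt, dist_zero_right] at h2
    exact h2.le
  obtain ⟨B, hB⟩ := (isCompact_Icc (a := 0) (b := t)).exists_bound_of_continuousOn hp.continuousOn
  have hB0 : 0 ≤ B := (norm_nonneg _).trans (hB t ⟨ht.le, le_rfl⟩)
  -- the contribution of `[0, t - η]`, where the kernel is smooth, is differentiable in `h`
  set R : ℝ → ℝ := fun s => B * ((s ^ α - (s - (t - η)) ^ α) / α) with hR
  have hRo : (fun h => R t - R (t - h)) =o[𝓝[>] 0] fun h => h ^ α := by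
    refine isLittleO_sub_of_differentiableAt hα₁ ?_
    have h1 : DifferentiableAt ℝ (fun s : ℝ => s ^ α) t :=
      Real.differentiableAt_rpow_const_of_ne α ht.ne'
    have h2 : DifferentiableAt ℝ (fun s : ℝ => (s - (t - η)) ^ α) t :=
      (differentiableAt_id.sub_const _).rpow_const (Or.inl (by simp; exact hη.ne'))
    exact ((h1.sub h2).div_const α).const_mul B
  filter_upwards [isLittleO_iff.1 hRo hε', self_mem_nhdsWithin,
    (Ioo_mem_nhdsGT hη)] with h hRh hh0 hhη
  have hh : 0 < h := hh0
  have hhα : 0 < h ^ α := Real.rpow_pos_of_pos hh α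
  have hI : ∀ (r c d : ℝ), IntervalIntegrable (fun s => (r - s) ^ (α - 1) * p s) volume c d :=
    fun r c d => intervalIntegrable_kernel_smul hα₀ r hp.continuousOn
  have hsplit : fracInt α p t - fracInt α p (t - h) = (Real.Gamma α)⁻¹ *
      ((∫ s in (t - h)..t, (t - s) ^ (α - 1) * p s) -
        ((∫ s in (0 : ℝ)..(t - η), ((t - h - s) ^ (α - 1) - (t - s) ^ (α - 1)) * p s) +
        ∫ s in (t - η)..(t - h), ((t - h - s) ^ (α - 1) - (t - s) ^ (α - 1)) * p s)) := by
    simp only [sub_mul]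
    rw [intervalIntegral.integral_sub (hI _ _ _) (hI _ _ _),
      intervalIntegral.integral_sub (hI _ _ _) (hI _ _ _)]
    have e1 := intervalIntegral.integral_add_adjacent_intervals (hI t 0 (t - η))
      (hI t (t - η) (t - h))
    have e2 := intervalIntegral.integral_add_adjacent_intervals (hI t 0 (t - h)) (hI t (t - h) t)
    have e3 := intervalIntegral.integral_add_adjacent_intervals (hI (t - h) 0 (t - η))
      (hI (t - h) (t - η) (t - h))
    simp only [fracInt, smul_eq_mul]
    rw [← e2, ← e3, ← e1]
    ring
  have b1 := norm_integral_kernel_le (b := ε') hα₀ (show t - h ≤ t by linarith)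
    (p := p) fun s hs => hsmall s ⟨by linarith [hs.1, hhη.2], hs.2⟩
  have b2 := norm_integral_kernel_sub_le (b := B) (c := 0) (d := t - η) (t := t) hα₀ hα₁ hh
    (by linarith) (by linarith [hhη.2]) (p := p) fun s hs => hB s ⟨hs.1, by linarith [hs.2]⟩
  have b3 := norm_integral_kernel_sub_le (b := ε') (c := t - η) (d := t - h) (t := t) hα₀ hα₁ hh
    (by linarith [hhη.2]) le_rfl (p := p) fun s hs => hsmall s ⟨hs.1, by linarith [hs.2]⟩
  have hmono : (η - h) ^ α ≤ η ^ α :=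
    Real.rpow_le_rpow (by linarith [hhη.2]) (by linarith) hα₀.le
  have b3' : ε' * (((t - h - (t - η)) ^ α - (t - h - (t - h)) ^ α) / α -
      ((t - (t - η)) ^ α - (t - (t - h)) ^ α) / α) ≤ ε' * (h ^ α / α) := by
    refine mul_le_mul_of_nonneg_left ?_ hε'.le
    rw [← sub_div, sub_self, Real.zero_rpow hα₀.ne', show t - h - (t - η) = η - h by ring,
      sub_sub_cancel, sub_sub_cancel]
    refine div_le_div_of_nonneg_right ?_ hα₀.le
    linarith
  have b2' : B * (((t - h - 0) ^ α - (t - h - (t - η)) ^ α) / α -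
      ((t - 0) ^ α - (t - (t - η)) ^ α) / α) ≤ ε' * h ^ α := by
    have e : B * (((t - h - 0) ^ α - (t - h - (t - η)) ^ α) / α -
      ((t - 0) ^ α - (t - (t - η)) ^ α) / α) = -(R t - R (t - h)) := by
      simp only [hR, sub_zero]; ring
    rw [e]
    refine (neg_le_abs _).trans ?_
    rwa [Real.norm_of_nonneg hhα.le] at hRh
  rw [sub_sub_cancel] at b1
  rw [hsplit, norm_mul, Real.norm_of_nonneg (inv_pos.2 hΓ).le, Real.norm_of_nonneg hhα.le, ← hεeq,
    mul_assoc]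
  refine mul_le_mul_of_nonneg_left ?_ (inv_pos.2 hΓ).le
  refine (norm_sub_le _ _).trans ?_
  have := norm_add_le
    (∫ s in (0 : ℝ)..(t - η), ((t - h - s) ^ (α - 1) - (t - s) ^ (α - 1)) * p s)
    (∫ s in (t - η)..(t - h), ((t - h - s) ^ (α - 1) - (t - s) ^ (α - 1)) * p s)
  have e : ε' * (2 / α + 1) * h ^ α = ε' * (h ^ α / α) + ε' * (h ^ α / α) + ε' * h ^ α := by ring
  rw [e]
  linarith

/-- At a positive time, the fractional integral of order `α` of a continuous function varies to the
left by `o(h ^ α)`, and not just by `O(h ^ α)`. -/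
theorem isLittleO_fracInt_sub {α t : ℝ} (hα₀ : 0 < α) (hα₁ : α < 1) (ht : 0 < t)
    {q : ℝ → ℝ} (hq : Continuous q) :
    (fun h => fracInt α q t - fracInt α q (t - h)) =o[𝓝[>] 0] fun h => h ^ α := by
  have h1 := isLittleO_fracInt_sub_of_eq_zero hα₀ hα₁ ht (p := fun s => q s - q t)
    (by fun_prop) (sub_self _)
  have h2 : (fun h => fracInt α (fun _ => q t) t - fracInt α (fun _ => q t) (t - h)) =o[𝓝[>] 0]
      fun h => h ^ α := by
    refine isLittleO_sub_of_differentiableAt hα₁ ?_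
    rw [funext (fracInt_const hα₀ (q t))]
    exact ((Real.differentiableAt_rpow_const_of_ne α ht.ne').div_const _).smul_const _
  refine (h1.add h2).congr_left fun h => ?_
  rw [fracInt_sub hα₀ (by fun_prop) (by fun_prop), fracInt_sub hα₀ (by fun_prop) (by fun_prop)]
  ring

/-! ### The extremum principle -/

/-- The extremum principle for the Caputo derivative. The little-o condition replaces the
differentiability of `u`, which solutions of fractional equations need not have. -/
theorem HasCaputoDerivAt.le_of_isMax {α t y : ℝ} (hα₀ : 0 < α) (hα₁ : α < 1) (ht : 0 < t)
    {u : ℝ → ℝ} (hu : Continuous u) (hmax : ∀ s ∈ Icc 0 t, u s ≤ u t)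
    (ho : (fun h => u t - u (t - h)) =o[𝓝[>] 0] fun h => h ^ α) (hy : HasCaputoDerivAt α u y t) :
    (u t - u 0) * (t ^ (-α) / Real.Gamma (1 - α)) ≤ y := by
  have ha : 0 < 1 - α := by linarith
  have hΓ := Real.Gamma_pos_of_pos ha
  -- it remains to see that `I^(1-α) v` has a nonpositive derivative at `t` for `v = u t - u ≥ 0`
  set v : ℝ → ℝ := fun s => u t - u s with hv
  have hvc : Continuous v := by fun_prop
  have hrepr : ∀ s, fracInt (1 - α) v s = (s ^ (1 - α) / Real.Gamma (1 - α + 1)) * (u t - u 0) -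
      rlIntegral (1 - α) (fun τ => u τ - u 0) s := by
    intro s
    rw [← smul_eq_mul, ← fracInt_const ha, rlIntegral_eq_fracInt,
      ← fracInt_sub ha (by fun_prop) (by fun_prop)]
    congr 1
    ext τ
    simp only [hv]
    ring
  have hW : HasDerivAt (fracInt (1 - α) v)
      ((u t - u 0) * (t ^ (-α) / Real.Gamma (1 - α)) - y) t := by
    have h1 := ((Real.hasDerivAt_rpow_const (p := 1 - α) (Or.inl ht.ne')).div_const
      (Real.Gamma (1 - α + 1))).mul_const (u t - u 0)
    rw [funext hrepr]
    convert! h1.sub hy using 1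
    rw [Real.Gamma_add_one ha.ne', sub_sub_cancel_left]
    field_simp
  set w := (u t - u 0) * (t ^ (-α) / Real.Gamma (1 - α)) - y with hw
  suffices w ≤ 0 by linarith
  have hslope : Tendsto (fun h => h⁻¹ * (fracInt (1 - α) v t - fracInt (1 - α) v (t - h)))
      (𝓝[>] 0) (𝓝 w) := by
    have h1 : HasDerivAt (fun h => -fracInt (1 - α) v (t - h)) w 0 := by
      have h2 : HasDerivAt (fun h : ℝ => t - h) (-1) 0 := (hasDerivAt_id 0).const_sub t
      have h3 : HasDerivAt (fracInt (1 - α) v) w (t - 0) := by rwa [sub_zero]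
      convert! (h3.comp 0 h2).neg using 1
      ring
    have h4 := (hasDerivAt_iff_tendsto_slope.1 h1).mono_left
      (nhdsWithin_mono 0 (fun h (hh : 0 < h) => hh.ne'))
    refine h4.congr fun h => ?_
    rw [slope_def_field, sub_zero, sub_zero]
    ring
  refine le_of_forall_pos_le_add fun ε hε => ?_
  obtain ⟨ε', hε', hεeq⟩ : ∃ ε', 0 < ε' ∧ (Real.Gamma (1 - α))⁻¹ * (ε' / (1 - α)) = ε :=
    ⟨ε * Real.Gamma (1 - α) * (1 - α), by positivity, by field_simp⟩
  rw [zero_add]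
  refine le_of_tendsto hslope ?_
  have ho' := isLittleO_iff.1 ho hε'
  obtain ⟨η, hη, hηo⟩ := mem_nhdsGT_iff_exists_Ioo_subset.1 ho'
  filter_upwards [Ioo_mem_nhdsGT (lt_min hη ht)] with h hh
  have hh0 := hh.1
  have hhη : h < η := hh.2.trans_le (min_le_left _ _)
  have hht : h < t := hh.2.trans_le (min_le_right _ _)
  have hI : ∀ (r c d : ℝ), IntervalIntegrable (fun s => (r - s) ^ (1 - α - 1) * v s) volume c d :=
    fun r c d => intervalIntegrable_kernel_smul ha r hvc.continuousOn
  -- on `[t - h, t]`, `v ≤ ε' * h ^ α`, and the kernel has integral `h ^ (1 - α) / (1 - α)`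
  have hlast : ∫ s in (t - h)..t, (t - s) ^ (1 - α - 1) * v s ≤
      (ε' * h ^ α) * ((t - (t - h)) ^ (1 - α) / (1 - α)) := by
    refine (Real.le_norm_self _).trans
      (norm_integral_kernel_le ha (by linarith) fun s hs => ?_)
    rcases hs.2.eq_or_lt with rfl | hst
    · simp only [hv, sub_self, norm_zero]
      have := Real.rpow_nonneg hh0.le α
      positivity
    · have h5 : ‖u t - u (t - (t - s))‖ ≤ ε' * ‖(t - s) ^ α‖ :=
        hηo ⟨by linarith, by linarith [hs.1]⟩
      rw [sub_sub_cancel, Real.norm_of_nonneg (Real.rpow_nonneg (by linarith) α)] at h5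
      exact h5.trans (mul_le_mul_of_nonneg_left
        (Real.rpow_le_rpow (by linarith) (by linarith [hs.1]) hα₀.le) hε'.le)
  -- the kernel decreases in `t`
  have hfirst : ∫ s in (0 : ℝ)..(t - h), (t - s) ^ (1 - α - 1) * v s ≤
      ∫ s in (0 : ℝ)..(t - h), (t - h - s) ^ (1 - α - 1) * v s := by
    refine intervalIntegral.integral_mono_on_of_le_Ioo (by linarith) (hI _ _ _) (hI _ _ _)
      fun s hs => ?_
    refine mul_le_mul_of_nonneg_right ?_ (sub_nonneg.2 (hmax s ⟨hs.1.le, by linarith [hs.2]⟩))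
    exact Real.rpow_le_rpow_of_nonpos (by linarith [hs.2]) (by linarith) (by linarith)
  have hadd := intervalIntegral.integral_add_adjacent_intervals (hI t 0 (t - h)) (hI t (t - h) t)
  have hpow : h ^ α * h ^ (1 - α) = h := by
    rw [← Real.rpow_add hh0, add_sub_cancel, Real.rpow_one]
  have hdiff : fracInt (1 - α) v t - fracInt (1 - α) v (t - h) ≤
      (Real.Gamma (1 - α))⁻¹ * (h * (ε' / (1 - α))) := by
    simp only [fracInt, smul_eq_mul]
    rw [← mul_sub]
    refine mul_le_mul_of_nonneg_left ?_ (inv_pos.2 hΓ).le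
    have e : (ε' * h ^ α) * ((t - (t - h)) ^ (1 - α) / (1 - α)) = h * (ε' / (1 - α)) := by
      rw [sub_sub_cancel]
      calc _ = (h ^ α * h ^ (1 - α)) * (ε' / (1 - α)) := by ring
        _ = _ := by rw [hpow]
    linarith
  rw [inv_mul_le_iff₀ hh0, ← hεeq]
  refine hdiff.trans_eq ?_
  ring

/-! ### Volterra equations with a Lipschitz right-hand side -/

/-- The bound behind the contraction in the weighted supremum norm. -/
theorem fracInt_exp_le {a l t : ℝ} (ha : 0 < a) (hl : 0 < l) (ht : 0 ≤ t) :
    fracInt a (fun s => Real.exp (l * s)) t ≤ (1 / l) ^ a * Real.exp (l * t) := by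
  have hΓ := Real.Gamma_pos_of_pos ha
  have h1 : ∫ τ in (0 : ℝ)..t, (t - τ) ^ (a - 1) * Real.exp (l * τ) =
      Real.exp (l * t) * ∫ s in (0 : ℝ)..t, s ^ (a - 1) * Real.exp (-(l * s)) := by
    have h := intervalIntegral.integral_comp_sub_left (a := 0) (b := t)
      (fun s => s ^ (a - 1) * Real.exp (-(l * s))) t
    rw [sub_self, sub_zero] at h
    rw [← h, ← intervalIntegral.integral_const_mul]
    congr 1
    ext τ
    rw [mul_left_comm, ← Real.exp_add]
    ring_nf
  have hint : IntegrableOn (fun s => s ^ (a - 1) * Real.exp (-(l * s))) (Ioi 0) := by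
    -- otherwise the integral would have the junk value `0`
    by_contra hcon
    have := Real.integral_rpow_mul_exp_neg_mul_Ioi ha hl
    rw [integral_undef hcon] at this
    have : 0 < (1 / l) ^ a * Real.Gamma a := by positivity
    linarith
  have h2 : ∫ s in (0 : ℝ)..t, s ^ (a - 1) * Real.exp (-(l * s)) ≤
      (1 / l) ^ a * Real.Gamma a := by
    rw [← Real.integral_rpow_mul_exp_neg_mul_Ioi ha hl, intervalIntegral.integral_of_le ht]
    refine setIntegral_mono_set hint ?_ Ioc_subset_Ioi_self.eventuallyLE
    refine (ae_restrict_iff' measurableSet_Ioi).2 (ae_of_all _ fun s hs => ?_)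
    have := Real.rpow_nonneg (le_of_lt hs) (a - 1)
    simp only [Pi.zero_apply]
    positivity
  unfold fracInt
  simp only [smul_eq_mul]
  rw [h1, inv_mul_le_iff₀ hΓ]
  calc _ ≤ Real.exp (l * t) * ((1 / l) ^ a * Real.Gamma a) := by gcongr
    _ = _ := by ring

/-- The weight `l` for which the Volterra operator halves distances. -/
theorem exists_weight {a K : ℝ} (ha : 0 < a) (hK : 0 ≤ K) :
    ∃ l : ℝ, 0 < l ∧ K * (1 / l) ^ a ≤ 1 / 2 := by
  refine ⟨(2 * K + 1) ^ a⁻¹, by positivity, ?_⟩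
  rw [one_div, Real.inv_rpow (by positivity), Real.rpow_inv_rpow (by positivity) ha.ne',
    ← div_eq_mul_inv, div_le_div_iff₀ (by positivity) two_pos]
  linarith

theorem norm_fracInt_le_exp {a l t C : ℝ} (ha : 0 < a) (hl : 0 < l) (ht : 0 ≤ t) (hC : 0 ≤ C)
    {z : ℝ → E} (hz : ∀ s ∈ Icc 0 t, ‖z s‖ ≤ C * Real.exp (l * s)) :
    ‖fracInt a z t‖ ≤ C * (1 / l) ^ a * Real.exp (l * t) := by
  refine (norm_fracInt_le ha ht (by fun_prop) hz).trans ?_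
  have h := fracInt_clm ha (t := t) (x := fun s => Real.exp (l * s)) (by fun_prop)
    (C • ContinuousLinearMap.id ℝ ℝ)
  simp only [smul_apply, ContinuousLinearMap.id_apply, smul_eq_mul] at h
  rw [h, mul_assoc]
  exact mul_le_mul_of_nonneg_left (fracInt_exp_le ha hl ht) hC

/-- A Volterra equation with weakly singular kernel and a globally Lipschitz right-hand side has a
solution on the whole half-line, obtained as a fixed point for the norm weighted by an
exponential. -/
theorem exists_volterra_solution [CompleteSpace E] {a : ℝ} (ha : 0 < a) {g : E → E} {K : NNReal}
    (hg : LipschitzWith K g) (hg0 : g 0 = 0) (x₀ : E) :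
    ∃ Φ : ℝ → E, Continuous Φ ∧ ∀ t, 0 ≤ t → Φ t = x₀ + fracInt a (fun s => g (Φ s)) t := by
  obtain ⟨l, hl, hKl⟩ := exists_weight ha K.coe_nonneg
  -- the unknown of the fixed point problem is `y t = exp (-l t) • Φ t`
  set e : (ℝ → E) → ℝ → E := fun y s => Real.exp (l * max s 0) • y s with he
  have hec : ∀ {y : ℝ → E}, Continuous y → Continuous (e y) := fun hy => by
    simp only [he]; fun_prop
  set T : (ℝ → E) → ℝ → E := fun y t =>
    Real.exp (-(l * max t 0)) • (x₀ + fracInt a (fun s => g (e y s)) (max t 0)) with hT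
  have hTc : ∀ {y : ℝ → E}, Continuous y → Continuous (T y) := fun hy => by
    have := continuous_comp_max_zero (continuousOn_fracInt ha (hg.continuous.comp (hec hy)))
    exact (by fun_prop : Continuous fun t => Real.exp (-(l * max t 0))).smul
      (continuous_const.add this)
  have hexp : ∀ t, Real.exp (-(l * max t 0)) * Real.exp (l * max t 0) = 1 := fun t => by
    rw [← Real.exp_add]; simp
  have hbound : ∀ (z : ℝ → E) (C t : ℝ), 0 ≤ C →
      (∀ s, 0 ≤ s → ‖z s‖ ≤ K * (C * Real.exp (l * s))) →
      ‖Real.exp (-(l * max t 0)) • fracInt a z (max t 0)‖ ≤ 1 / 2 * C := by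
    intro z C t hC hz
    have h := norm_fracInt_le_exp ha hl (le_max_right t 0) (C := K * C) (by positivity) (z := z)
      fun s hs => (hz s hs.1).trans_eq (by ring)
    rw [norm_smul, Real.norm_of_nonneg (Real.exp_pos _).le]
    calc _ ≤ Real.exp (-(l * max t 0)) * (K * C * (1 / l) ^ a * Real.exp (l * max t 0)) := by
          gcongr
      _ = (Real.exp (-(l * max t 0)) * Real.exp (l * max t 0)) * ((K * (1 / l) ^ a) * C) := by ring
      _ ≤ _ := by rw [hexp, one_mul]; gcongr
  have henorm : ∀ (y : ℝ → E) (C s : ℝ), ‖y s‖ ≤ C → 0 ≤ s →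
      ‖e y s‖ ≤ C * Real.exp (l * s) := by
    intro y C s hy hs
    simp only [he, norm_smul, max_eq_left hs, Real.norm_of_nonneg (Real.exp_pos _).le]
    rw [mul_comm]
    gcongr
  have hTb : ∀ (y : BoundedContinuousFunction ℝ E) (t : ℝ), ‖T y t‖ ≤ ‖x₀‖ + 1 / 2 * ‖y‖ := by
    intro y t
    simp only [hT, smul_add]
    refine (norm_add_le _ _).trans (add_le_add ?_ (hbound _ _ t (norm_nonneg y) fun s hs => ?_))
    · rw [norm_smul, Real.norm_of_nonneg (Real.exp_pos _).le]
      refine mul_le_of_le_one_left (norm_nonneg _) (Real.exp_le_one_iff.2 ?_)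
      have := le_max_right t 0
      simp only [Left.neg_nonpos_iff]
      positivity
    · have h := hg.norm_sub_le (e y s) 0
      rw [hg0, sub_zero, sub_zero] at h
      exact h.trans (mul_le_mul_of_nonneg_left (henorm y _ s (y.norm_coe_le_norm s) hs) K.coe_nonneg)
  let S : BoundedContinuousFunction ℝ E → BoundedContinuousFunction ℝ E := fun y =>
    BoundedContinuousFunction.ofNormedAddCommGroup (T y) (hTc y.continuous) _ (hTb y)
  have hS : ContractingWith (1 / 2) S := by
    refine ⟨by norm_num, LipschitzWith.of_dist_le_mul fun y z => ?_⟩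
    rw [BoundedContinuousFunction.dist_le (by positivity)]
    intro t
    change dist (T y t) (T z t) ≤ _
    have hd : T y t - T z t = Real.exp (-(l * max t 0)) •
        fracInt a (fun s => g (e y s) - g (e z s)) (max t 0) := by
      rw [fracInt_sub ha (x := fun s => g (e y s)) (y := fun s => g (e z s))
        (hg.continuous.comp (hec y.continuous)).continuousOn
        (hg.continuous.comp (hec z.continuous)).continuousOn]
      simp only [hT, ← smul_sub, add_sub_add_left_eq_sub]
    rw [dist_eq_norm, hd]
    refine (hbound _ (dist y z) t dist_nonneg fun s hs => ?_).trans_eq (by norm_num)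
    refine (hg.norm_sub_le _ _).trans (mul_le_mul_of_nonneg_left ?_ K.coe_nonneg)
    have : e y s - e z s = e (fun r => y r - z r) s := by simp only [he, smul_sub]
    rw [this]
    refine henorm (fun r => y r - z r) _ s ?_ hs
    rw [← dist_eq_norm]
    exact BoundedContinuousFunction.dist_coe_le_dist s
  obtain ⟨y, hy⟩ : ∃ y, S y = y := ⟨_, hS.fixedPoint_isFixedPt⟩
  refine ⟨e y, hec y.continuous, fun t ht => ?_⟩
  have h : y t = T y t := congrFun (congrArg DFunLike.coe hy.symm) t
  have h2 : e y t = Real.exp (l * max t 0) • T y t := by rw [← h]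
  rw [h2]
  simp only [hT, smul_smul]
  rw [mul_comm, hexp, one_smul, max_eq_left ht]

/-- Uniqueness for the Volterra equation on `[0, τ]`: in the weighted supremum norm, the distance of
two solutions is at most half of itself. -/
theorem volterra_solution_unique {a τ : ℝ} (ha : 0 < a) {g : E → E} {K : NNReal}
    (hg : LipschitzWith K g) {x₀ : E} {x y : ℝ → E} (hx : Continuous x) (hy : Continuous y)
    (hxe : ∀ t ∈ Icc 0 τ, x t = x₀ + fracInt a (fun s => g (x s)) t)
    (hye : ∀ t ∈ Icc 0 τ, y t = x₀ + fracInt a (fun s => g (y s)) t) :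
    ∀ t ∈ Icc 0 τ, x t = y t := by
  intro t₀ ht₀
  obtain ⟨l, hl, hKl⟩ := exists_weight ha K.coe_nonneg
  obtain ⟨s, hs, hmax⟩ := isCompact_Icc.exists_isMaxOn (f := fun s => Real.exp (-(l * s)) *
    ‖x s - y s‖) ⟨t₀, ht₀⟩ (by fun_prop)
  set N := Real.exp (-(l * s)) * ‖x s - y s‖ with hN
  have hN0 : 0 ≤ N := by positivity
  have hexp : ∀ t, Real.exp (-(l * t)) * Real.exp (l * t) = 1 := fun t => by
    rw [← Real.exp_add]; simp
  have hbd : ∀ t ∈ Icc 0 τ, ‖x t - y t‖ ≤ N * Real.exp (l * t) := fun t ht => by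
    calc ‖x t - y t‖ = (Real.exp (-(l * t)) * ‖x t - y t‖) * Real.exp (l * t) := by
          rw [mul_right_comm, hexp, one_mul]
      _ ≤ _ := by gcongr; exact hmax ht
  have hself : ‖x s - y s‖ ≤ K * N * (1 / l) ^ a * Real.exp (l * s) := by
    have hd : x s - y s = fracInt a (fun r => g (x r) - g (y r)) s := by
      rw [fracInt_sub ha (x := fun r => g (x r)) (y := fun r => g (y r))
        (hg.continuous.comp hx).continuousOn (hg.continuous.comp hy).continuousOn]
      nth_rewrite 1 [hxe s hs, hye s hs]
      abel
    rw [hd]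
    refine norm_fracInt_le_exp ha hl hs.1 (by positivity) fun r hr => ?_
    refine (hg.norm_sub_le _ _).trans ?_
    rw [mul_assoc]
    exact mul_le_mul_of_nonneg_left (hbd r ⟨hr.1, hr.2.trans hs.2⟩) K.2
  have hNle : N ≤ 1 / 2 * N := by
    calc N ≤ Real.exp (-(l * s)) * (K * N * (1 / l) ^ a * Real.exp (l * s)) := by
          rw [hN]; gcongr
      _ = (Real.exp (-(l * s)) * Real.exp (l * s)) * ((K * (1 / l) ^ a) * N) := by ring
      _ ≤ 1 / 2 * N := by rw [hexp, one_mul]; gcongr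
  have h := hbd t₀ ht₀
  rw [show N = 0 by linarith, zero_mul] at h
  exact sub_eq_zero.1 (norm_le_zero_iff.1 h)

/-! ### Maximal solutions -/

theorem eqOn_of_integral_eq {τ : ℝ} {u v : ℝ → ℝ} (hτ : 0 < τ) (hu : Continuous u)
    (hv : Continuous v) (h : ∀ s ∈ Icc 0 τ, ∫ r in (0 : ℝ)..s, u r = ∫ r in (0 : ℝ)..s, v r) :
    EqOn u v (Icc 0 τ) := by
  have h1 : EqOn u v (Ioo 0 τ) := fun s hs => by
    refine (hu.integral_hasStrictDerivAt 0 s).hasDerivAt.unique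
      ((hv.integral_hasStrictDerivAt 0 s).hasDerivAt.congr_of_eventuallyEq ?_)
    filter_upwards [Ioo_mem_nhds hs.1 hs.2] with r hr using h r ⟨hr.1.le, hr.2.le⟩
  have h2 := h1.closure hu hv
  rwa [closure_Ioo hτ.ne] at h2

/-- A function with continuous Caputo derivative `q` is recovered from `q` by fractional
integration. -/
theorem HasCaputoDerivAt.eq_add_fracInt {α τ : ℝ} (hα₀ : 0 < α) (hα₁ : α < 1) (hτ : 0 < τ)
    {u q : ℝ → ℝ} (hu : Continuous u) (hq : Continuous q)
    (h : ∀ t ∈ Ioo 0 τ, HasCaputoDerivAt α u (q t) t) :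
    ∀ t ∈ Icc 0 τ, u t = u 0 + fracInt α q t := by
  have h1 : 0 < 1 - α := by linarith
  have hv : Continuous fun s => u s - u 0 := by fun_prop
  have hJ : ∀ s ∈ Icc 0 τ, fracInt (1 - α) (fun s => u s - u 0) s = fracInt 1 q s := by
    intro s hs
    have := intervalIntegral.integral_eq_sub_of_hasDerivAt_of_le hs.1
      (f := fracInt (1 - α) (fun s => u s - u 0)) (f' := q)
      ((continuousOn_fracInt h1 hv).mono Icc_subset_Ici_self)
      (fun r hr => h r ⟨hr.1, hr.2.trans_le hs.2⟩) (hq.intervalIntegrable _ _)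
    rw [fracInt_zero_right, sub_zero] at this
    rw [fracInt_one, this]
  have hI := eqOn_of_integral_eq hτ hv (continuous_comp_max_zero (continuousOn_fracInt hα₀ hq))
    fun s hs => by
      rw [← fracInt_one, ← fracInt_one,
        fracInt_congr hs.1 (x := fun r => fracInt α q (max r 0)) (y := fracInt α q)
          fun r hr => by rw [max_eq_left hr.1],
        fracInt_fracInt one_pos hα₀ hs.1 hq, add_comm, ← fracInt_fracInt hα₀ one_pos hs.1 hq,
        ← fracInt_congr hs.1 fun r hr => hJ r ⟨hr.1, hr.2.trans hs.2⟩,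
        fracInt_fracInt hα₀ h1 hs.1 hv, add_sub_cancel]
  intro t ht
  have := hI ht
  simp only [max_eq_left ht.1] at this
  linarith

theorem continuous_euclidean_apply {x : ℝ → EuclideanSpace ℝ (Fin d)} (hx : Continuous x)
    (i : Fin d) : Continuous fun s => x s i :=
  (EuclideanSpace.proj (𝕜 := ℝ) i).continuous.comp hx

theorem fracInt_apply {a t : ℝ} (ha : 0 < a) {x : ℝ → EuclideanSpace ℝ (Fin d)}
    (hx : Continuous x) (i : Fin d) : fracInt a x t i = fracInt a (fun s => x s i) t :=
  (fracInt_clm ha hx.continuousOn (EuclideanSpace.proj (𝕜 := ℝ) i)).symm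

/-- The Caputo derivative at an interior point of `[0, τ]` depends only on the values on
`[0, τ]`. -/
theorem HasCaputoDerivAt.congr_of_eqOn {α τ t y : ℝ} {u v : ℝ → ℝ} (huv : EqOn u v (Icc 0 τ))
    (ht : t ∈ Ioo 0 τ) (h : HasCaputoDerivAt α u y t) : HasCaputoDerivAt α v y t := by
  refine HasDerivAt.congr_of_eventuallyEq h ?_
  filter_upwards [Ioo_mem_nhds ht.1 ht.2] with s hs
  rw [rlIntegral_eq_fracInt]
  refine fracInt_congr hs.1.le fun r hr => ?_
  rw [huv ⟨hr.1, hr.2.trans hs.2.le⟩, huv ⟨le_rfl, (hs.1.trans hs.2).le⟩]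

/-- As long as a solution stays in the region where `f` agrees with the Lipschitz map `g`, it
coincides with the solution of the Volterra equation for `g`. -/
theorem IsSolution.eq_volterra_solution {α : ℝ} (hα₀ : 0 < α) (hα₁ : α < 1)
    {D B : Set (EuclideanSpace ℝ (Fin d))}
    {f g : EuclideanSpace ℝ (Fin d) → EuclideanSpace ℝ (Fin d)} {K : NNReal}
    (hg : LipschitzWith K g) (hfg : EqOn f g B) {x₀ : EuclideanSpace ℝ (Fin d)}
    {Φ ψ : ℝ → EuclideanSpace ℝ (Fin d)} {S : EReal} (hΦ : Continuous Φ)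
    (hΦe : ∀ t, 0 ≤ t → Φ t = x₀ + fracInt α (fun s => g (Φ s)) t)
    (hψ : IsSolution α D f x₀ S ψ) {τ : ℝ} (hτ : 0 < τ) (hτS : (τ : EReal) < S)
    (hB : ∀ s ∈ Icc 0 τ, ψ s ∈ B) : ∀ t ∈ Icc 0 τ, ψ t = Φ t := by
  have hlt : ∀ s, s ≤ τ → (s : EReal) < S := fun s hs =>
    (EReal.coe_le_coe_iff.2 hs).trans_lt hτS
  -- freezing `ψ` outside `[0, τ]` makes it continuous on the whole line
  set χ : ℝ → EuclideanSpace ℝ (Fin d) := fun s => ψ (projIcc 0 τ hτ.le s) with hχ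
  have hχc : Continuous χ := by
    refine hψ.cont.comp_continuous (by fun_prop) fun s => ?_
    have := (projIcc 0 τ hτ.le s).2
    exact ⟨this.1, hlt _ this.2⟩
  have hχψ : EqOn ψ χ (Icc 0 τ) := fun s hs => by simp only [hχ, projIcc_of_mem hτ.le hs]
  clear_value χ
  have hχe : ∀ t ∈ Icc 0 τ, χ t = x₀ + fracInt α (fun s => g (χ s)) t := by
    intro t ht
    ext i
    have hc : Continuous fun s => g (χ s) := hg.continuous.comp hχc
    rw [PiLp.add_apply, fracInt_apply hα₀ hc]
    have h0 : χ 0 = x₀ := by rw [← hχψ ⟨le_rfl, hτ.le⟩, hψ.init]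
    rw [← h0]
    have hder : ∀ s ∈ Ioo 0 τ, HasCaputoDerivAt α (fun s => χ s i) (g (χ s) i) s := ?_
    · exact HasCaputoDerivAt.eq_add_fracInt hα₀ hα₁ hτ (u := fun s => χ s i)
        (q := fun s => g (χ s) i) (continuous_euclidean_apply hχc i)
        (continuous_euclidean_apply hc i) hder t ht
    intro s hs
    have h := hψ.caputo s hs.1 (hlt s hs.2.le) i
    have hs' := Ioo_subset_Icc_self hs
    rw [hfg (hB s hs'), hχψ hs'] at h
    exact h.congr_of_eqOn (fun r hr => by simp only [hχψ hr]) hs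
  intro t ht
  rw [hχψ ht]
  exact volterra_solution_unique hα₀ hg hχc hΦ hχe (fun s hs => hΦe s hs.1) t ht

/-- A global solution of the Volterra equation for `g` that stays in the open ball of radius `ρ` is
the maximal solution of the original problem: no other solution can leave the ball. -/
theorem isMaximalSolution_of_volterra {α ρ : ℝ} (hα₀ : 0 < α) (hα₁ : α < 1)
    {D : Set (EuclideanSpace ℝ (Fin d))} (hρD : Metric.closedBall 0 ρ ⊆ D)
    {f g : EuclideanSpace ℝ (Fin d) → EuclideanSpace ℝ (Fin d)} {K : NNReal}
    (hg : LipschitzWith K g) (hfg : EqOn f g (Metric.closedBall 0 ρ))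
    {x₀ : EuclideanSpace ℝ (Fin d)} {Φ : ℝ → EuclideanSpace ℝ (Fin d)} (hΦ : Continuous Φ)
    (hΦe : ∀ t, 0 ≤ t → Φ t = x₀ + fracInt α (fun s => g (Φ s)) t)
    (hΦρ : ∀ t, 0 ≤ t → ‖Φ t‖ < ρ) : IsMaximalSolution α D f x₀ ⊤ Φ := by
  have hmem : ∀ t, 0 ≤ t → Φ t ∈ Metric.closedBall (0 : EuclideanSpace ℝ (Fin d)) ρ :=
    fun t ht => mem_closedBall_zero_iff.2 (hΦρ t ht).le
  have hinit : Φ 0 = x₀ := by rw [hΦe 0 le_rfl, fracInt_zero_right, add_zero]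
  have hc : Continuous fun s => g (Φ s) := hg.continuous.comp hΦ
  refine ⟨⟨EReal.zero_lt_top, hinit, hΦ.continuousOn, fun t ht _ => hρD (hmem t ht),
    fun t ht _ i => ?_⟩, fun S ψ hψ => ⟨le_top, fun t ht htS => ?_⟩⟩
  · rw [hfg (hmem t ht.le)]
    have hi : ∀ s, 0 ≤ s → Φ s i = Φ 0 i + fracInt α (fun s => g (Φ s) i) s := fun s hs => by
      rw [hinit, ← fracInt_apply hα₀ hc, ← PiLp.add_apply, ← hΦe s hs]
    exact hasCaputoDerivAt_of_volterra hα₀ hα₁ ht (x := fun s => Φ s i)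
      (q := fun s => g (Φ s) i) (continuous_euclidean_apply hc i) hi
  · rcases ht.eq_or_lt with rfl | ht0
    · rw [hψ.init, hinit]
    have hcont : ContinuousOn ψ (Icc 0 t) := hψ.cont.mono fun s hs =>
      ⟨hs.1, (EReal.coe_le_coe_iff.2 hs.2).trans_lt htS⟩
    -- if `ψ` left the open ball, it would still agree with `Φ` at the exit time
    have hin : ∀ s ∈ Icc 0 t, ‖ψ s‖ < ρ := by
      by_contra! hcon
      have hcpt : IsCompact (Icc 0 t ∩ {s | ρ ≤ ‖ψ s‖}) :=
        isCompact_Icc.of_isClosed_subset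
          (hcont.norm.preimage_isClosed_of_isClosed isClosed_Icc isClosed_Ici) inter_subset_left
      obtain ⟨σ, ⟨hσ, hσρ⟩, hleast⟩ := hcpt.exists_isLeast
        (let ⟨s, hs, h⟩ := hcon; ⟨s, hs, h⟩)
      have hσρ' : ρ ≤ ‖ψ σ‖ := hσρ
      have hσ0 : 0 < σ := by
        refine lt_of_le_of_ne hσ.1 fun h => ?_
        have := hΦρ 0 le_rfl
        rw [← h, hψ.init, ← hinit] at hσρ'
        linarith
      have hbefore : ∀ s ∈ Ico 0 σ, ‖ψ s‖ ≤ ρ := fun s hs => by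
        by_contra! h
        exact absurd (hleast ⟨⟨hs.1, hs.2.le.trans hσ.2⟩, h.le⟩) (not_le.2 hs.2)
      have hcl : ∀ s ∈ Icc 0 σ, ψ s ∈ Metric.closedBall (0 : EuclideanSpace ℝ (Fin d)) ρ := by
        intro s hs
        have hcs := (hcont.mono (Icc_subset_Icc_right hσ.2)).norm
        rw [← closure_Ico hσ0.ne] at hs hcs
        exact mem_closedBall_zero_iff.2 (le_on_closure hbefore hcs continuousOn_const hs)
      have h := hψ.eq_volterra_solution hα₀ hα₁ hg hfg hΦ hΦe hσ0
        ((EReal.coe_le_coe_iff.2 hσ.2).trans_lt htS) hcl σ ⟨hσ0.le, le_rfl⟩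
      have := hΦρ σ hσ0.le
      rw [← h] at this
      linarith
    exact hψ.eq_volterra_solution hα₀ hα₁ hg hfg hΦ hΦe ht0 htS
      (fun s hs => mem_closedBall_zero_iff.2 (hin s hs).le) t ⟨ht, le_rfl⟩

/-! ### Comparison for convex Lyapunov functions -/

/-- A differentiable convex function lies above its tangent hyperplanes. -/
theorem add_inner_gradient_le_of_convexOn {H : Type*} [NormedAddCommGroup H] [InnerProductSpace ℝ H]
    [CompleteSpace H] {V : H → ℝ} (hV : ConvexOn ℝ univ V) {x : H} (hx : DifferentiableAt ℝ V x)
    (z : H) : V x + inner ℝ (gradient V x) (z - x) ≤ V z := by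
  have hconv : ConvexOn ℝ univ (V ∘ AffineMap.lineMap (k := ℝ) x z) := hV.comp_affineMap _
  have hd : HasDerivAt (V ∘ AffineMap.lineMap (k := ℝ) x z) (inner ℝ (gradient V x) (z - x)) 0 := by
    have h1 : HasFDerivAt V (InnerProductSpace.toDual ℝ H (gradient V x))
        (AffineMap.lineMap (k := ℝ) x z (0 : ℝ)) := by
      rw [AffineMap.lineMap_apply_zero]
      exact hx.hasGradientAt.hasFDerivAt
    have h2 : HasDerivAt (AffineMap.lineMap (k := ℝ) x z) (z - x) 0 :=
      AffineMap.hasDerivAt_lineMap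
    simpa using h1.comp_hasDerivAt 0 h2
  have h := hconv.le_slope_of_hasDerivAt (mem_univ 0) (mem_univ 1) one_pos hd
  rw [slope_def_field, Function.comp_apply, Function.comp_apply, AffineMap.lineMap_apply_one,
    AffineMap.lineMap_apply_zero, sub_zero, div_one] at h
  linarith

theorem hasCaputoDerivAt_const (α t m : ℝ) : HasCaputoDerivAt α (fun _ => m) 0 t := by
  simp only [HasCaputoDerivAt, sub_self]
  have : rlIntegral (1 - α) (fun _ => 0) = fun _ => (0 : ℝ) := by ext; simp [rlIntegral]
  rw [this]
  exact hasDerivAt_const t 0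

/-- Comparison principle: if `M` is a supersolution, in the sense that its Caputo derivative `M'`
dominates `⟪∇V x, g x⟫` on the level sets `V x = M t`, then `V` stays below `M` along the solution.
As `M` stays below the values of `V` on the sphere of radius `ε`, the solution is confined to the
open ball. The comparison is made at the first contact, with a linear functional of `Φ` in place of
`V ∘ Φ`, which need not have a Caputo derivative. -/
theorem lyapunov_comparison {α : ℝ} (hα₀ : 0 < α) (hα₁ : α < 1)
    {g : EuclideanSpace ℝ (Fin d) → EuclideanSpace ℝ (Fin d)} (hg : Continuous g)
    {x₀ : EuclideanSpace ℝ (Fin d)} {Φ : ℝ → EuclideanSpace ℝ (Fin d)} (hΦ : Continuous Φ)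
    (hΦe : ∀ t, 0 ≤ t → Φ t = x₀ + fracInt α (fun s => g (Φ s)) t)
    {V : EuclideanSpace ℝ (Fin d) → ℝ} (hVconv : ConvexOn ℝ univ V) (hVdiff : Differentiable ℝ V)
    {ε m : ℝ} (hsphere : ∀ x, ‖x‖ = ε → m ≤ V x) {M M' : ℝ → ℝ} (hM : Continuous M)
    (hMdiff : ∀ t, 0 < t → DifferentiableAt ℝ M t)
    (hM' : ∀ t, 0 < t → HasCaputoDerivAt α M (M' t) t) (hMm : ∀ t, 0 ≤ t → M t ≤ m)
    (hdecr : ∀ x t, 0 < t → ‖x‖ ≤ ε → V x = M t → inner ℝ (gradient V x) (g x) ≤ M' t)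
    (hx₀ε : ‖x₀‖ < ε) (hx₀M : V x₀ < M 0) :
    ∀ t, 0 ≤ t → ‖Φ t‖ < ε ∧ V (Φ t) < M t := by
  have hinit : Φ 0 = x₀ := by rw [hΦe 0 le_rfl, fracInt_zero_right, add_zero]
  have hVΦ : Continuous fun t => V (Φ t) := hVdiff.continuous.comp hΦ
  by_contra! hcon
  obtain ⟨t₁, ht₁, hbad⟩ := hcon
  have hcl : IsClosed ({t | ε ≤ ‖Φ t‖} ∪ {t | M t ≤ V (Φ t)}) :=
    (isClosed_le continuous_const hΦ.norm).union (isClosed_le hM hVΦ)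
  obtain ⟨t, ⟨ht, htbad⟩, hleast⟩ := (isCompact_Icc.inter_right hcl).exists_isLeast
    ⟨t₁, ⟨ht₁, le_rfl⟩, or_iff_not_imp_left.2 fun h => hbad (not_le.1 h)⟩
  have ht0 : 0 < t := by
    refine lt_of_le_of_ne ht.1 fun h => ?_
    rw [← h] at htbad
    rcases htbad with h' | h' <;> simp only [mem_ofPred_eq, hinit] at h' <;> linarith
  have hbefore : ∀ s ∈ Ico 0 t, ‖Φ s‖ < ε ∧ V (Φ s) < M s := fun s hs => by
    by_contra h
    refine not_le.2 hs.2 (hleast ⟨⟨hs.1, hs.2.le.trans ht.2⟩, ?_⟩)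
    simp only [mem_union, mem_ofPred_eq]
    by_contra! h'
    exact h h'
  have hupto : ∀ s ∈ Icc 0 t, ‖Φ s‖ ≤ ε ∧ V (Φ s) ≤ M s := fun s hs => by
    rw [← closure_Ico ht0.ne] at hs
    exact ⟨le_on_closure (fun r hr => (hbefore r hr).1.le) hΦ.norm.continuousOn
      continuousOn_const hs, le_on_closure (fun r hr => (hbefore r hr).2.le) hVΦ.continuousOn
      hM.continuousOn hs⟩
  have htt := hupto t ⟨ht0.le, le_rfl⟩
  have hcontact : V (Φ t) = M t := by
    refine le_antisymm htt.2 ?_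
    rcases htbad with h | h
    · exact (hMm t ht0.le).trans (hsphere _ (le_antisymm htt.1 h))
    · exact h
  -- linearize `V` at the contact point: the linear functional `⟪c, ·⟫` has a Caputo derivative
  -- along `Φ`, and by convexity `⟪c, Φ s⟫ - M s` is largest at `s = t`
  set c := gradient V (Φ t) with hc
  have hgΦ : Continuous fun s => g (Φ s) := hg.comp hΦ
  have hq : Continuous fun s => inner ℝ c (g (Φ s)) := continuous_const.inner hgΦ
  have hyc : Continuous fun s => inner ℝ c (Φ s) := continuous_const.inner hΦ
  have hy : ∀ s, 0 ≤ s → inner ℝ c (Φ s) =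
      inner ℝ c (Φ 0) + fracInt α (fun s => inner ℝ c (g (Φ s))) s := fun s hs => by
    have h := fracInt_clm hα₀ (t := s) hgΦ.continuousOn (innerSL ℝ c)
    simp only [innerSL_apply_apply] at h
    rw [h, hinit, ← inner_add_right, ← hΦe s hs]
  have hcap := (hasCaputoDerivAt_of_volterra hα₀ hα₁ ht0 (x := fun s => inner ℝ c (Φ s)) hq hy).sub
    hα₁ hyc hM (hM' t ht0)
  have hlin : ∀ s, inner ℝ c (Φ s) - inner ℝ c (Φ t) ≤ V (Φ s) - V (Φ t) := fun s => by
    have := add_inner_gradient_le_of_convexOn hVconv (hVdiff (Φ t)) (Φ s)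
    rw [← hc, inner_sub_right] at this
    linarith
  have ho : (fun h => (inner ℝ c (Φ t) - M t) - (inner ℝ c (Φ (t - h)) - M (t - h)))
      =o[𝓝[>] 0] fun h => h ^ α := by
    refine ((isLittleO_fracInt_sub hα₀ hα₁ ht0 hq).sub
      (isLittleO_sub_of_differentiableAt hα₁ (hMdiff t ht0))).congr' ?_ EventuallyEq.rfl
    filter_upwards [Ioo_mem_nhdsGT ht0] with h hh
    rw [hy t ht0.le, hy (t - h) (by linarith [hh.2])]
    ring
  -- `u 0 < u t`, so that the extremum principle gives a strict sign
  have hext := hcap.le_of_isMax hα₀ hα₁ ht0 (u := fun s => inner ℝ c (Φ s) - M s) (hyc.sub hM)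
    (fun s hs => by linarith [hlin s, (hupto s hs).2]) ho
  have hstrict : 0 < (inner ℝ c (Φ t) - M t) - (inner ℝ c (Φ 0) - M 0) := by
    have := hlin 0
    rw [hinit] at this ⊢
    linarith
  have hpos : 0 < t ^ (-α) / Real.Gamma (1 - α) :=
    div_pos (Real.rpow_pos_of_pos ht0 _) (Real.Gamma_pos_of_pos (by linarith))
  have hprod := mul_pos hstrict hpos
  have hle := hdecr (Φ t) t ht0 htt.1 hcontact
  linarith

/-- `f` is replaced by a globally Lipschitz extension from the closed ball; the comparison principle
keeps the resulting solution in the ball, where the two maps agree. -/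
theorem exists_isMaximalSolution_of_lyapunov {α : ℝ} (hα₀ : 0 < α) (hα₁ : α < 1)
    {D : Set (EuclideanSpace ℝ (Fin d))}
    {f : EuclideanSpace ℝ (Fin d) → EuclideanSpace ℝ (Fin d)} (hf0 : f 0 = 0)
    {V : EuclideanSpace ℝ (Fin d) → ℝ} (hVconv : ConvexOn ℝ univ V) (hVdiff : Differentiable ℝ V)
    {ε m : ℝ} (hεD : Metric.closedBall 0 ε ⊆ D) {K : NNReal}
    (hfLip : LipschitzOnWith K f (Metric.closedBall 0 ε))
    (hsphere : ∀ x, ‖x‖ = ε → m ≤ V x) {M M' : ℝ → ℝ} (hM : Continuous M)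
    (hMdiff : ∀ t, 0 < t → DifferentiableAt ℝ M t)
    (hM' : ∀ t, 0 < t → HasCaputoDerivAt α M (M' t) t) (hMm : ∀ t, 0 ≤ t → M t ≤ m)
    (hdecr : ∀ x t, 0 < t → ‖x‖ ≤ ε → V x = M t → inner ℝ (gradient V x) (f x) ≤ M' t)
    {x₀ : EuclideanSpace ℝ (Fin d)} (hx₀ε : ‖x₀‖ < ε) (hx₀M : V x₀ < M 0) :
    ∃ Φ, IsMaximalSolution α D f x₀ ⊤ Φ ∧ ∀ t, 0 ≤ t → ‖Φ t‖ < ε ∧ V (Φ t) < M t := by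
  obtain ⟨g, hg, hfg⟩ := hfLip.extend_finite_dimension
  have hε : 0 < ε := (norm_nonneg _).trans_lt hx₀ε
  have hg0 : g 0 = 0 := by rw [← hfg (Metric.mem_closedBall_self hε.le), hf0]
  obtain ⟨Φ, hΦ, hΦe⟩ := exists_volterra_solution hα₀ hg hg0 x₀
  have hbd := lyapunov_comparison hα₀ hα₁ hg.continuous hΦ hΦe hVconv hVdiff hsphere hM hMdiff hM'
    hMm (fun x t ht hx hxM => by
      rw [← hfg (mem_closedBall_zero_iff.2 hx)]
      exact hdecr x t ht hx hxM) hx₀ε hx₀M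
  exact ⟨Φ, isMaximalSolution_of_volterra hα₀ hα₁ hεD hg hfg hΦ hΦe fun t ht => (hbd t ht).1, hbd⟩

/-! ### A supersolution with power decay -/

/-- The Beta integrand is integrable because its integral is not the junk value `0`. -/
theorem intervalIntegrable_beta {a b t : ℝ} (ha : 0 < a) (hb : 0 < b) (ht : 0 < t) :
    IntervalIntegrable (fun s => (t - s) ^ (a - 1) * s ^ (b - 1)) volume 0 t := by
  by_contra hcon
  have h := integral_beta ha hb ht
  rw [intervalIntegral.integral_undef hcon] at h
  have := Real.Gamma_pos_of_pos ha
  have := Real.Gamma_pos_of_pos hb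
  have := Real.Gamma_pos_of_pos (add_pos ha hb)
  have : 0 < Real.Gamma a * Real.Gamma b / Real.Gamma (a + b) * t ^ (a + b - 1) := by positivity
  linarith

theorem continuous_one_add_max_rpow (p : ℝ) : Continuous fun s : ℝ => (1 + max s 0) ^ p :=
  (by fun_prop : Continuous fun s : ℝ => 1 + max s 0).rpow_const fun s =>
    Or.inl (by have := le_max_right s 0; linarith)

/-- The fractional integral of order `1 - α` of `(1 + s)⁻¹` decays like a negative power. -/
theorem exists_fracInt_inv_le {α : ℝ} (hα₀ : 0 < α) (hα₁ : α < 1) :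
    ∃ C, 0 < C ∧ ∀ t, 0 < t →
      fracInt (1 - α) (fun s => (1 + max s 0) ^ (-1 : ℝ)) t ≤ C * (1 + t) ^ (-(α / 2)) := by
  have h1 : 0 < 1 - α := by linarith
  have h2 : 0 < 1 - α / 2 := by linarith
  have h3 : 0 < α / 2 := by linarith
  have hΓ1 := Real.Gamma_pos_of_pos h1
  have hΓ2 := Real.Gamma_pos_of_pos h2
  have hΓ3 := Real.Gamma_pos_of_pos h3
  have hΓ4 := Real.Gamma_pos_of_pos hα₀
  refine ⟨(Real.Gamma (1 - α))⁻¹ * (Real.Gamma (1 - α) * Real.Gamma α +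
    Real.Gamma (1 - α / 2) * Real.Gamma (α / 2)), by positivity, fun t ht => ?_⟩
  have hB1 := integral_beta h1 hα₀ ht
  have hB2 := integral_beta h2 h3 ht
  rw [sub_add_cancel, sub_self, Real.rpow_zero, Real.Gamma_one, div_one, mul_one] at hB1 hB2
  have hi1 := intervalIntegrable_beta h1 hα₀ ht
  have hi2 := intervalIntegrable_beta h2 h3 ht
  rw [← hB1, ← hB2, ← intervalIntegral.integral_add hi1 hi2, fracInt, smul_eq_mul, mul_assoc]
  refine mul_le_mul_of_nonneg_left ?_ (inv_pos.2 hΓ1).le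
  rw [← intervalIntegral.integral_mul_const]
  refine intervalIntegral.integral_mono_on_of_le_Ioo ht.le
    (intervalIntegrable_kernel_smul h1 t (continuous_one_add_max_rpow _).continuousOn)
    ((hi1.add hi2).mul_const _) fun s hs => ?_
  have hs0 : 0 < s := hs.1
  have hts : 0 < t - s := sub_pos.2 hs.2
  have h1t : 0 < 1 + t := by linarith
  have h1s : 0 < 1 + s := by linarith
  rw [max_eq_left hs0.le, Real.rpow_neg h1t.le, ← div_eq_mul_inv,
    le_div_iff₀ (Real.rpow_pos_of_pos h1t _), smul_eq_mul]
  -- `1 + t ≤ (1 + s) (1 + (t - s))`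
  have k1 : (1 + t) ^ (α / 2) ≤ (1 + s) ^ (α / 2) * (1 + (t - s) ^ (α / 2)) := by
    have e1 : (1 + t) ^ (α / 2) ≤ ((1 + s) * (1 + (t - s))) ^ (α / 2) :=
      Real.rpow_le_rpow h1t.le (by nlinarith) h3.le
    rw [Real.mul_rpow h1s.le (by linarith)] at e1
    have e2 := Real.rpow_add_le_add_rpow zero_le_one hts.le h3.le (by linarith : α / 2 ≤ 1)
    rw [Real.one_rpow] at e2
    exact e1.trans (mul_le_mul_of_nonneg_left e2 (Real.rpow_nonneg h1s.le _))
  have k2 : ∀ b, α / 2 ≤ b → b < 1 → (1 + s) ^ (-1 : ℝ) * (1 + s) ^ (α / 2) ≤ s ^ (b - 1) := by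
    intro b hb hb1
    rw [← Real.rpow_add h1s]
    calc (1 + s) ^ (-1 + α / 2) ≤ (1 + s) ^ (b - 1) :=
          Real.rpow_le_rpow_of_exponent_le (by linarith) (by linarith)
      _ ≤ s ^ (b - 1) := Real.rpow_le_rpow_of_nonpos hs0 (by linarith) (by linarith)
  have k3 : (t - s) ^ (1 - α / 2 - 1) = (t - s) ^ (1 - α - 1) * (t - s) ^ (α / 2) := by
    rw [← Real.rpow_add hts]
    congr 1
    ring
  have n1 := Real.rpow_nonneg hts.le (1 - α - 1)
  have n2 := Real.rpow_nonneg hts.le (α / 2)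
  have n3 := Real.rpow_nonneg h1s.le (-1)
  calc (t - s) ^ (1 - α - 1) * (1 + s) ^ (-1 : ℝ) * (1 + t) ^ (α / 2)
      ≤ (t - s) ^ (1 - α - 1) * (1 + s) ^ (-1 : ℝ) *
          ((1 + s) ^ (α / 2) * (1 + (t - s) ^ (α / 2))) := by gcongr
    _ = (t - s) ^ (1 - α - 1) * ((1 + s) ^ (-1 : ℝ) * (1 + s) ^ (α / 2)) +
          (t - s) ^ (1 - α - 1) * (t - s) ^ (α / 2) *
            ((1 + s) ^ (-1 : ℝ) * (1 + s) ^ (α / 2)) := by ring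
    _ ≤ _ := by
      rw [k3]
      gcongr
      · exact k2 α (by linarith) hα₁
      · exact k2 (α / 2) le_rfl (by linarith)

/-- The cutoff `max s 0` makes the power function continuous on `ℝ` without changing it on
`[0, ∞)`. -/
theorem hasCaputoDerivAt_power {α t : ℝ} (hα₁ : α < 1) (ht : 0 < t) (m β : ℝ) :
    HasCaputoDerivAt α (fun s => m * (1 + max s 0) ^ (-β))
      (-(m * β) * fracInt (1 - α) (fun s => (1 + max s 0) ^ (-β - 1)) t) t := by
  have h1 : 0 < 1 - α := by linarith
  have hc := continuous_one_add_max_rpow (-β - 1)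
  have e : -(m * β) * fracInt (1 - α) (fun s => (1 + max s 0) ^ (-β - 1)) t =
      fracInt (1 - α) (fun s => -(m * β) * (1 + max s 0) ^ (-β - 1)) t := by
    have h := fracInt_clm h1 (t := t) hc.continuousOn
      ((-(m * β)) • ContinuousLinearMap.id ℝ ℝ)
    simp only [smul_apply, ContinuousLinearMap.id_apply, smul_eq_mul] at h
    exact h.symm
  rw [e]
  refine hasCaputoDerivAt_of_eq_add_integral hα₁ ht (hc.const_mul _) fun s hs => ?_
  have h := intervalIntegral.integral_eq_sub_of_hasDerivAt_of_le hs
    (f := fun s => m * (1 + max s 0) ^ (-β)) (f' := fun s => -(m * β) * (1 + max s 0) ^ (-β - 1))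
    ((continuous_one_add_max_rpow (-β)).const_mul m).continuousOn (fun r hr => ?_)
    ((hc.const_mul _).intervalIntegrable _ _)
  · rw [h]; ring
  · have hd := ((((hasDerivAt_id r).const_add 1).rpow_const (p := -β)
      (Or.inl (by simp only [id]; linarith [hr.1]))).const_mul m)
    have hd' : HasDerivAt (fun s => m * (1 + s) ^ (-β)) (-(m * β) * (1 + max r 0) ^ (-β - 1)) r := by
      convert! hd using 1
      rw [max_eq_left hr.1.le]
      simp only [id]
      ring
    refine hd'.congr_of_eventuallyEq ?_
    filter_upwards [lt_mem_nhds hr.1] with s hs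
    rw [max_eq_left hs.le]

theorem differentiableAt_power {t : ℝ} (ht : 0 < t) (m β : ℝ) :
    DifferentiableAt ℝ (fun s => m * (1 + max s 0) ^ (-β)) t := by
  have hd : DifferentiableAt ℝ (fun s : ℝ => m * (1 + s) ^ (-β)) t :=
    ((differentiableAt_id.const_add 1).rpow_const
      (Or.inl (by simp only [id]; linarith))).const_mul m
  refine hd.congr_of_eventuallyEq ?_
  filter_upwards [lt_mem_nhds ht] with s hs
  rw [max_eq_left hs.le]

/-- The power function `m (1 + t) ^ (-β)` with small `β` is a supersolution of the scalar equation
`ᶜD^α M = -k M ^ p`. -/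
theorem exists_power_supersolution {α k m p : ℝ} (hα₀ : 0 < α) (hα₁ : α < 1) (hk : 0 < k)
    (hm : 0 < m) (hp : 0 ≤ p) :
    ∃ β, 0 < β ∧ ∀ t, 0 < t → -(k * (m * (1 + max t 0) ^ (-β)) ^ p) ≤
      -(m * β) * fracInt (1 - α) (fun s => (1 + max s 0) ^ (-β - 1)) t := by
  obtain ⟨C, hC, hCt⟩ := exists_fracInt_inv_le hα₀ hα₁
  have h1 : 0 < 1 - α := by linarith
  have hmp := Real.rpow_pos_of_pos hm p
  refine ⟨min (α / 2 / (p + 1)) (k * m ^ p / (m * C)), by positivity, fun t ht => ?_⟩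
  set β := min (α / 2 / (p + 1)) (k * m ^ p / (m * C)) with hβ
  have hβ0 : 0 < β := by positivity
  have hβ1 : β * p ≤ α / 2 := by
    have := (le_div_iff₀ (by linarith)).1 (min_le_left (α / 2 / (p + 1)) (k * m ^ p / (m * C)))
    rw [← hβ] at this
    linarith
  have hβ2 : m * β * C ≤ k * m ^ p := by
    have := (le_div_iff₀ (by positivity)).1
      (min_le_right (α / 2 / (p + 1)) (k * m ^ p / (m * C)))
    rw [← hβ] at this
    linarith
  have h1t : 0 < 1 + t := by linarith
  have hI : fracInt (1 - α) (fun s => (1 + max s 0) ^ (-β - 1)) t ≤ C * (1 + t) ^ (-(α / 2)) := by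
    refine (fracInt_mono h1 ht.le (continuous_one_add_max_rpow _).continuousOn
      (continuous_one_add_max_rpow _).continuousOn fun s _ => ?_).trans (hCt t ht)
    have := le_max_right s 0
    exact Real.rpow_le_rpow_of_exponent_le (by linarith) (by linarith)
  rw [max_eq_left ht.le, neg_mul, neg_le_neg_iff, Real.mul_rpow hm.le (Real.rpow_nonneg h1t.le _),
    ← Real.rpow_mul h1t.le]
  calc m * β * fracInt (1 - α) (fun s => (1 + max s 0) ^ (-β - 1)) t
      ≤ m * β * (C * (1 + t) ^ (-(α / 2))) := by gcongr
    _ = (m * β * C) * (1 + t) ^ (-(α / 2)) := by ring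
    _ ≤ (k * m ^ p) * (1 + t) ^ (-β * p) := by
      refine mul_le_mul hβ2 (Real.rpow_le_rpow_of_exponent_le (by linarith) (by linarith))
        (Real.rpow_nonneg h1t.le _) (by positivity)
    _ = k * (m ^ p * (1 + t) ^ (-β * p)) := by ring

end FracODE

theorem theorem5p3 (d : ℕ) (hd : 0 < d) (α : ℝ) (hα₀ : 0 < α) (hα₁ : α < 1)
    (D : Set (EuclideanSpace ℝ (Fin d))) (hD : IsOpen D) (h0D : 0 ∈ D)
    (f : EuclideanSpace ℝ (Fin d) → EuclideanSpace ℝ (Fin d)) (hf0 : f 0 = 0)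
    (hfLip : ∃ K : NNReal, ∃ U ∈ nhds (0 : EuclideanSpace ℝ (Fin d)), LipschitzOnWith K f U)
    (V : EuclideanSpace ℝ (Fin d) → ℝ) (hVnonneg : ∀ x, 0 ≤ V x)
    (hVconv : ConvexOn ℝ Set.univ V) (hVdiff : Differentiable ℝ V)
    (a b C₁ C₂ r : ℝ) (ha : 0 < a) (hb : 0 < b) (hC₁ : 0 < C₁) (hC₂ : 0 < C₂) (hr : 0 < r)
    (hVbound : ∀ x ∈ Metric.closedBall (0 : EuclideanSpace ℝ (Fin d)) r,
      C₁ * ‖x‖ ^ a ≤ V x ∧ V x ≤ C₂ * ‖x‖ ^ b)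
    (C₃ c : ℝ) (hC₃ : 0 ≤ C₃) (hc : 0 ≤ c)
    (hVdecr : ∀ x ∈ Metric.closedBall (0 : EuclideanSpace ℝ (Fin d)) r, x ∈ D →
      inner ℝ (gradient V x) (f x) ≤ -C₃ * ‖x‖ ^ c) :
    (C₃ = 0 → FracODE.IsStable α D f) ∧
      (0 < C₃ → FracODE.IsMittagLefflerStable α D f) := by
  obtain ⟨K, U, hU, hKU⟩ := hfLip
  obtain ⟨ρ, hρ, hρUD⟩ := Metric.nhds_basis_closedBall.mem_iff.1
    (Filter.inter_mem hU (hD.mem_nhds h0D))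
  have hV0 : V 0 = 0 := by
    refine le_antisymm ?_ (hVnonneg 0)
    have := (hVbound 0 (Metric.mem_closedBall_self hr.le)).2
    rwa [norm_zero, Real.zero_rpow hb.ne', mul_zero] at this
  have hsphere : ∀ ε, ε ≤ r → ∀ x, ‖x‖ = ε → C₁ * ε ^ a ≤ V x := fun ε hε x hx => by
    rw [← hx]
    exact (hVbound x (mem_closedBall_zero_iff.2 (hx.trans_le hε))).1
  have hsub : ∀ ε, ε ≤ ρ → Metric.closedBall (0 : EuclideanSpace ℝ (Fin d)) ε ⊆ U ∩ D := fun ε hε =>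
    (Metric.closedBall_subset_closedBall hε).trans hρUD
  have hsmall : ∀ ε m : ℝ, 0 < ε → 0 < m → ∃ δ, 0 < δ ∧
      ∀ x : EuclideanSpace ℝ (Fin d), ‖x‖ ≤ δ → ‖x‖ < ε ∧ V x < m := by
    intro ε m hε hm
    have hnear : ∀ᶠ x : EuclideanSpace ℝ (Fin d) in nhds 0, ‖x‖ < ε ∧ V x < m := by
      refine Filter.Eventually.and ?_ ?_
      · exact continuous_norm.continuousAt.eventually_lt continuousAt_const (by simpa)
      · exact hVdiff.continuous.continuousAt.eventually_lt continuousAt_const (by simpa [hV0])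
    obtain ⟨δ, hδ, h⟩ := Metric.nhds_basis_closedBall.mem_iff.1 hnear
    exact ⟨δ, hδ, fun x hx => h (mem_closedBall_zero_iff.2 hx)⟩
  constructor
  -- stability: the constant `C₁ * ε ^ a` is a supersolution
  · intro hC₃0 ε₀ hε₀
    set ε := min ε₀ (min ρ r) with hε
    have hε0 : 0 < ε := by positivity
    have hερ : ε ≤ ρ := (min_le_right _ _).trans (min_le_left _ _)
    have hεr : ε ≤ r := (min_le_right _ _).trans (min_le_right _ _)
    obtain ⟨δ, hδ, hδV⟩ := hsmall ε (C₁ * ε ^ a) hε0 (by positivity)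
    refine ⟨δ, hδ, fun x₀ hx₀ => ?_⟩
    obtain ⟨Φ, hΦ, hbd⟩ := FracODE.exists_isMaximalSolution_of_lyapunov hα₀ hα₁ hf0 hVconv hVdiff
      (fun x hx => (hsub ε hερ hx).2) (hKU.mono fun x hx => (hsub ε hερ hx).1) (hsphere ε hεr)
      (M := fun _ => C₁ * ε ^ a) (M' := fun _ => 0) continuous_const
      (fun t _ => differentiableAt_const _) (fun t _ => FracODE.hasCaputoDerivAt_const α t _)
      (fun _ _ => le_rfl) (fun x t _ hx _ => by
        have := hVdecr x (mem_closedBall_zero_iff.2 (hx.trans hεr))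
          (hsub ε hερ (mem_closedBall_zero_iff.2 hx)).2
        rwa [hC₃0, neg_zero, zero_mul] at this)
      (hδV x₀ hx₀.le).1 (hδV x₀ hx₀.le).2
    exact ⟨Φ, hΦ, fun t ht => (hbd t ht).1.trans_le (min_le_left _ _)⟩
  · intro hC₃pos
    set ε := min ρ r with hε
    have hε0 : 0 < ε := by positivity
    have hερ : ε ≤ ρ := min_le_left _ _
    have hεr : ε ≤ r := min_le_right _ _
    -- `m` is a lower bound of `V` on the sphere of radius `ε`
    set m := C₁ * ε ^ a with hm
    have hm0 : 0 < m := by positivity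
    have hp : 0 ≤ c / b := by positivity
    set k := C₃ * (1 / C₂) ^ (c / b) with hk
    have hk0 : 0 < k := by positivity
    obtain ⟨β, hβ, hsuper⟩ := FracODE.exists_power_supersolution hα₀ hα₁ hk0 hm0 hp
    obtain ⟨δ, hδ, hδV⟩ := hsmall ε m hε0 hm0
    refine ⟨β / a, (m / C₁) ^ (1 / a), δ, by positivity, by positivity, hδ, fun x₀ hx₀ => ?_⟩
    have hpow : ∀ t : ℝ, 0 < (1 + max t 0) ∧ (1 + max t 0) ^ (-β) ≤ 1 := fun t => by
      have := le_max_right t 0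
      exact ⟨by linarith, Real.rpow_le_one_of_one_le_of_nonpos (by linarith) (by linarith)⟩
    -- `V ≤ C₂ ‖x‖ ^ b` turns the decay rate in terms of `‖x‖` into one in terms of `V`
    have hdec : ∀ x : EuclideanSpace ℝ (Fin d), ‖x‖ ≤ ε →
        inner ℝ (gradient V x) (f x) ≤ -(k * V x ^ (c / b)) := by
      intro x hx
      have hxr := mem_closedBall_zero_iff.2 (hx.trans hεr)
      refine (hVdecr x hxr (hsub ε hερ (mem_closedBall_zero_iff.2 hx)).2).trans ?_
      rw [neg_mul, neg_le_neg_iff, hk, mul_assoc, ← Real.mul_rpow (by positivity) (hVnonneg x)]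
      refine mul_le_mul_of_nonneg_left ?_ hC₃
      have h1 : 1 / C₂ * V x ≤ ‖x‖ ^ b := by
        rw [one_div, inv_mul_le_iff₀ hC₂]
        exact (hVbound x hxr).2
      calc (1 / C₂ * V x) ^ (c / b) ≤ (‖x‖ ^ b) ^ (c / b) :=
            Real.rpow_le_rpow (mul_nonneg (by positivity) (hVnonneg x)) h1 hp
        _ = ‖x‖ ^ c := by
            rw [← Real.rpow_mul (norm_nonneg x), mul_div_cancel₀ c hb.ne']
    obtain ⟨Φ, hΦ, hbd⟩ := FracODE.exists_isMaximalSolution_of_lyapunov hα₀ hα₁ hf0 hVconv hVdiff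
      (fun x hx => (hsub ε hερ hx).2) (hKU.mono fun x hx => (hsub ε hερ hx).1) (hsphere ε hεr)
      (M := fun t => m * (1 + max t 0) ^ (-β))
      ((FracODE.continuous_one_add_max_rpow _).const_mul m)
      (fun t ht => FracODE.differentiableAt_power ht m β)
      (fun t ht => FracODE.hasCaputoDerivAt_power hα₁ ht m β)
      (fun t _ => mul_le_of_le_one_right hm0.le (hpow t).2)
      (fun x t ht hx hxM => (hdec x hx).trans (by rw [hxM]; exact hsuper t ht))
      (hδV x₀ hx₀).1 (by simpa using (hδV x₀ hx₀).2)
    refine ⟨Φ, hΦ, fun t ht => ?_⟩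
    have h1t : 0 < 1 + t := by linarith
    have h := hbd t ht
    rw [max_eq_left ht] at h
    have hΦa : ‖Φ t‖ ^ a ≤ m / C₁ * (1 + t) ^ (-β) := by
      have := (hVbound (Φ t) (mem_closedBall_zero_iff.2 (h.1.le.trans hεr))).1
      rw [div_mul_eq_mul_div, le_div_iff₀ hC₁, mul_comm]
      linarith
    have hprod : (t ^ (β / a) * ‖Φ t‖) ^ a ≤ m / C₁ := by
      rw [Real.mul_rpow (by positivity) (norm_nonneg _), ← Real.rpow_mul ht,
        div_mul_cancel₀ β ha.ne']
      calc t ^ β * ‖Φ t‖ ^ a ≤ (1 + t) ^ β * (m / C₁ * (1 + t) ^ (-β)) := by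
            gcongr
            linarith
        _ = m / C₁ := by
            rw [Real.rpow_neg h1t.le]
            have := (Real.rpow_pos_of_pos h1t β).ne'
            field_simp
    calc t ^ (β / a) * ‖Φ t‖ = ((t ^ (β / a) * ‖Φ t‖) ^ a) ^ (1 / a) := by
          rw [one_div, Real.rpow_rpow_inv (by positivity) ha.ne']
      _ ≤ (m / C₁) ^ (1 / a) := Real.rpow_le_rpow (by positivity) hprod (by positivity)
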